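/- Let $\mathcal H^2_0$ be the Hilbert space of Dirichlet series $f(s)=\sum_{n\ge 2}a_n n^{-s}$ with $\|f\|^2=\sum_{n\ge2}|a_n|^2<\infty$; every such series converges absolutely for $\operatorname{Re}s>1/2$. Let $\mathbf H:\mathcal H^2_0\to\mathcal H^2_0$ be the bounded operator $$\mathbf Hf(s)=\int_{1/2}^{\infty}f(w)\,(\zeta(w+s)-1)\,dw,\qquad \operatorname{Re}s>1/2,$$ where $\zeta$ is the Riemann zeta function, and let $\psi(s)=\sum_{n\ge2}\frac{1}{\sqrt n\,\log n}\,n^{-s}$, which belongs to $\mathcal H^2_0$. Then: 1. $\mathbf H$ has no point spectrum: there are no $\mu\in\mathbb C$ and $f\in\mathcal H^2_0$, $f\ne0$, with $\mathbf Hf=\mu f$. 2. If $0<\lambda<\pi$ and $f\in\mathcal H^2_0$, $c\in\mathbb C$ satisfy $(\mathbf H-\lambda)f=c\,\psi$, then $f=0$ and $c=0$. 3. For $0<\lambda<\pi$ the operator $\mathbf H-\lambda$ does not map $\mathcal H^2_0$ onto $\mathcal H^2_0$. 4. The spectrum of $\mathbf H$ is $[0,\pi]$ and it is purely continuous: for every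 $\mu\in[0,\pi]$ the operator $\mathbf H-\mu$ is injective and has dense range, but is not surjective. -/

import Mathlib

noncomputable section

namespace MulHilbert

open Set MeasureTheory

/-- The index set of the integers `n ≥ 2`. -/
abbrev Idx : Type := {n : ℕ // 2 ≤ n}
/-- The Hilbert space of Dirichlet series `f(s) = ∑_{n ≥ 2} a_n n^{-s}` with square-summable
coefficients, a series being given by its coefficients; the norm is the `ℓ²` norm of `(a_n)`. -/
abbrev H20 : Type := lp (fun _ : Idx => ℂ) 2

/-- The value at `s` of the Dirichlet series `f`; the series converges absolutely for `1/2 < Re s`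
(see `summable_norm_eval`), and the values there determine `f` (see `eval_injective`). -/
def eval (f : H20) (s : ℂ) : ℂ := ∑' n : Idx, f n * ((n : ℕ) : ℂ) ^ (-s)

lemma log_pos (n : Idx) : 0 < Real.log (n : ℕ) :=
  Real.log_pos (by exact_mod_cast (lt_of_lt_of_le one_lt_two n.2))

lemma cast_pos (n : Idx) : (0 : ℝ) < (n : ℕ) := by
  exact_mod_cast (lt_of_lt_of_le zero_lt_two n.2)

/-- The entries `1 / (√(mn) log(mn))` of the multiplicative Hilbert matrix. -/
def ker (m n : Idx) : ℝ :=
  1 / (√((m : ℕ) * (n : ℕ)) * Real.log ((m : ℕ) * (n : ℕ)))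

lemma log_mul' (m n : Idx) :
    Real.log ((m : ℕ) * (n : ℕ)) = Real.log (m : ℕ) + Real.log (n : ℕ) :=
  Real.log_mul (cast_pos m).ne' (cast_pos n).ne'

lemma ker_pos (m n : Idx) : 0 < ker m n := by
  have := log_pos m; have := log_pos n; have := cast_pos m; have := cast_pos n
  rw [ker, log_mul']
  positivity

lemma ker_comm (m n : Idx) : ker m n = ker n m := by
  rw [ker, ker, mul_comm ((m : ℕ) : ℝ)]

lemma step {N : ℝ} (hN : 0 < N) (i : ℕ) :
    √N / ((i + 2 : ℝ) * (√(Real.log (i + 2)) * (Real.log (i + 2) + N))) ≤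
      2 * Real.arctan √(Real.log (i + 2) / N) - 2 * Real.arctan √(Real.log (i + 1) / N) := by
  set L := Real.log (i + 2) with hL
  set l := Real.log (i + 1) with hl
  have hi : (0 : ℝ) ≤ i := Nat.cast_nonneg i
  have hl0 : 0 ≤ l := Real.log_nonneg (by linarith)
  have hlL : l < L := Real.log_lt_log (by linarith) (by linarith)
  have hdiff : 1 / (i + 2 : ℝ) ≤ L - l := by
    have h := Real.one_sub_inv_le_log_of_pos (x := ((i : ℝ) + 2) / (i + 1)) (by positivity)
    rw [Real.log_div (by positivity) (by positivity)] at h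
    refine le_trans (le_of_eq ?_) h
    field_simp
    ring
  have hder : ∀ x ∈ Ioo l L, HasDerivAt (fun x => 2 * Real.arctan √(x / N))
      (√N / (√x * (x + N))) x := by
    intro x hx
    have hx0 : 0 < x := lt_of_le_of_lt hl0 hx.1
    have h1 : HasDerivAt (fun x : ℝ => x / N) (1 / N) x := (hasDerivAt_id x).div_const N
    have h2 := ((h1.sqrt (by positivity)).arctan).const_mul 2
    refine h2.congr_deriv ?_
    rw [Real.sq_sqrt (by positivity), Real.sqrt_div hx0.le]
    have := Real.sqrt_pos.2 hN
    have := Real.sqrt_pos.2 hx0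
    have e := Real.sq_sqrt hN.le
    field_simp
    ring
  obtain ⟨c, hc, hceq⟩ := exists_hasDerivAt_eq_slope (fun x => 2 * Real.arctan √(x / N))
    (fun x => √N / (√x * (x + N))) hlL (by
      refine Continuous.continuousOn ?_
      exact continuous_const.mul (Real.continuous_arctan.comp
        (Real.continuous_sqrt.comp (continuous_id.div_const N)))) hder
  have hc0 : 0 < c := lt_of_le_of_lt hl0 hc.1
  have hL0 : 0 < L := hc0.trans hc.2
  have h3 : √N / (√L * (L + N)) ≤ √N / (√c * (c + N)) := by
    have := Real.sqrt_pos.2 hc0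
    have h4 := Real.sqrt_le_sqrt hc.2.le
    have h5 := hc.2.le
    gcongr
  have h6 : (2 * Real.arctan √(L / N) - 2 * Real.arctan √(l / N)) =
      √N / (√c * (c + N)) * (L - l) := by
    rw [hceq]; field_simp [sub_pos.2 hlL |>.ne']
  rw [h6]
  calc √N / ((i + 2 : ℝ) * (√L * (L + N))) = √N / (√L * (L + N)) * (1 / (i + 2 : ℝ)) := by
        field_simp
    _ ≤ _ := by gcongr

lemma sum_bound {N : ℝ} (hN : 0 < N) (s : Finset Idx) :
    ∑ m ∈ s, √N / (((m : ℕ) : ℝ) * (√(Real.log (m : ℕ)) * (Real.log (m : ℕ) + N))) ≤ Real.pi := by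
  set φ : ℕ → ℝ := fun i => √N / ((i + 2 : ℝ) * (√(Real.log (i + 2)) * (Real.log (i + 2) + N)))
    with hφ
  have hφ0 : ∀ i, 0 ≤ φ i := by
    intro i
    have : 0 ≤ Real.log ((i : ℝ) + 2) := Real.log_nonneg (by linarith [Nat.cast_nonneg (α := ℝ) i])
    positivity
  have h1 : ∑ m ∈ s, √N / (((m : ℕ) : ℝ) * (√(Real.log (m : ℕ)) * (Real.log (m : ℕ) + N)))
      = ∑ i ∈ s.image (fun m : Idx => (m : ℕ) - 2), φ i := by
    rw [Finset.sum_image]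
    · refine Finset.sum_congr rfl fun m _ => ?_
      have : (((m : ℕ) - 2 : ℕ) : ℝ) + 2 = (m : ℕ) := by
        rw [Nat.cast_sub m.2]; push_cast; ring
      simp only [hφ, this]
    · intro a _ b _ h
      have := a.2; have := b.2
      apply Subtype.ext
      simp only at h
      omega
  rw [h1]
  obtain ⟨M, hM⟩ := (s.image (fun m : Idx => (m : ℕ) - 2)).exists_nat_subset_range
  refine (Finset.sum_le_sum_of_subset_of_nonneg hM fun i _ _ => hφ0 i).trans ?_
  set g : ℕ → ℝ := fun i => 2 * Real.arctan √(Real.log (i + 1) / N)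
  have h2 : ∑ i ∈ Finset.range M, φ i ≤ ∑ i ∈ Finset.range M, (g (i + 1) - g i) := by
    refine Finset.sum_le_sum fun i _ => (step hN i).trans (le_of_eq ?_)
    simp only [g]
    push_cast
    ring_nf
  refine h2.trans ?_
  rw [Finset.sum_range_sub]
  have h3 : g 0 = 0 := by simp [g]
  have h4 : g M ≤ Real.pi := by
    have := (Real.arctan_lt_pi_div_two √(Real.log (M + 1) / N)).le
    simp only [g]; linarith
  linarith

/-- Weights for the Schur test. -/
def wt (m n : Idx) : ℝ :=
  (√(Real.log (n : ℕ)) * √(n : ℕ)) / (√(Real.log (m : ℕ)) * √(m : ℕ))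

lemma wt_pos (m n : Idx) : 0 < wt m n := by
  have := log_pos m; have := log_pos n; have := cast_pos m; have := cast_pos n
  rw [wt]; positivity

lemma wt_mul (m n : Idx) : wt m n * wt n m = 1 := by
  have := log_pos m; have := log_pos n; have := cast_pos m; have := cast_pos n
  rw [wt, wt]; field_simp

lemma schur_row (n : Idx) (s : Finset Idx) : ∑ m ∈ s, ker m n * wt m n ≤ Real.pi := by
  refine le_trans (le_of_eq ?_) (sum_bound (log_pos n) s)
  refine Finset.sum_congr rfl fun m _ => ?_
  have := log_pos m; have := log_pos n; have hm := cast_pos m; have hn := cast_pos n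
  rw [ker, wt, log_mul', Real.sqrt_mul hm.le]
  have e := Real.sq_sqrt hm.le
  have : 0 < √((m : ℕ) : ℝ) := Real.sqrt_pos.2 hm
  field_simp
  rw [e]

lemma schur_finite (a : Idx → ℝ) (s t : Finset Idx) :
    ∑ n ∈ t, (∑ m ∈ s, ker m n * a m) ^ 2 ≤ Real.pi ^ 2 * ∑ m ∈ s, a m ^ 2 := by
  have h1 : ∀ n, (∑ m ∈ s, ker m n * a m) ^ 2 ≤
      Real.pi * ∑ m ∈ s, ker n m * wt n m * a m ^ 2 := by
    intro n
    have := Finset.sum_sq_le_sum_mul_sum_of_sq_le_mul s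
      (r := fun m => ker m n * a m) (f := fun m => ker m n * wt m n)
      (g := fun m => ker n m * wt n m * a m ^ 2)
      (fun m _ => (mul_pos (ker_pos m n) (wt_pos m n)).le)
      (fun m _ => mul_nonneg (mul_pos (ker_pos n m) (wt_pos n m)).le (sq_nonneg _))
      (fun m _ => by
        rw [ker_comm n m]
        have := wt_mul m n
        apply le_of_eq
        linear_combination (-(ker m n) ^ 2 * a m ^ 2) * this)
    refine this.trans ?_
    refine mul_le_mul_of_nonneg_right (schur_row n s) ?_
    exact Finset.sum_nonneg fun m _ =>
      mul_nonneg (mul_pos (ker_pos n m) (wt_pos n m)).le (sq_nonneg _)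
  calc ∑ n ∈ t, (∑ m ∈ s, ker m n * a m) ^ 2
      ≤ ∑ n ∈ t, Real.pi * ∑ m ∈ s, ker n m * wt n m * a m ^ 2 :=
        Finset.sum_le_sum fun n _ => h1 n
    _ = Real.pi * ∑ m ∈ s, (∑ n ∈ t, ker n m * wt n m) * a m ^ 2 := by
        rw [← Finset.mul_sum, Finset.sum_comm]
        simp_rw [Finset.sum_mul]
    _ ≤ Real.pi * ∑ m ∈ s, Real.pi * a m ^ 2 := by
        refine mul_le_mul_of_nonneg_left ?_ Real.pi_pos.le
        exact Finset.sum_le_sum fun m _ => mul_le_mul_of_nonneg_right (schur_row m t) (sq_nonneg _)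
    _ = _ := by rw [← Finset.mul_sum]; ring

lemma sum_sq_le (f : H20) (s : Finset Idx) : ∑ m ∈ s, ‖f m‖ ^ 2 ≤ ‖f‖ ^ 2 := by
  simpa using lp.sum_rpow_le_norm_rpow (p := 2) (by norm_num) f s

lemma summable_ker (f : H20) (n : Idx) : Summable fun m => ker m n * ‖f m‖ := by
  refine summable_of_sum_le (c := Real.pi * ‖f‖)
    (fun m => mul_nonneg (ker_pos m n).le (norm_nonneg _)) fun s => ?_
  have h := schur_finite (fun m => ‖f m‖) s {n}
  simp only [Finset.sum_singleton] at h
  refine abs_le_of_sq_le_sq' ?_ (by positivity) |>.2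
  rw [mul_pow]
  exact h.trans (mul_le_mul_of_nonneg_left (sum_sq_le f s) (by positivity))

lemma schur_tsum (f : H20) (t : Finset Idx) :
    ∑ n ∈ t, (∑' m, ker m n * ‖f m‖) ^ 2 ≤ (Real.pi * ‖f‖) ^ 2 := by
  refine le_of_tendsto (tendsto_finsetSum t fun n _ => (summable_ker f n).hasSum.pow 2)
    (Filter.Eventually.of_forall fun s => ?_)
  rw [mul_pow]
  exact (schur_finite (fun m => ‖f m‖) s t).trans
    (mul_le_mul_of_nonneg_left (sum_sq_le f s) (by positivity))

/-- The multiplicative Hilbert matrix applied to the coefficients of `f`. -/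
def coef (f : H20) (n : Idx) : ℂ := ∑' m, (ker m n : ℂ) * f m

lemma summable_coef (f : H20) (n : Idx) : Summable fun m => (ker m n : ℂ) * f m := by
  refine Summable.of_norm_bounded (summable_ker f n) fun m => ?_
  rw [norm_mul, Complex.norm_real, Real.norm_of_nonneg (ker_pos m n).le]

lemma norm_coef_le (f : H20) (n : Idx) : ‖coef f n‖ ≤ ∑' m, ker m n * ‖f m‖ := by
  refine tsum_of_norm_bounded (summable_ker f n).hasSum fun m => ?_
  rw [norm_mul, Complex.norm_real, Real.norm_of_nonneg (ker_pos m n).le]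

lemma sum_coef_le (f : H20) (t : Finset Idx) :
    ∑ n ∈ t, ‖coef f n‖ ^ 2 ≤ (Real.pi * ‖f‖) ^ 2 :=
  (Finset.sum_le_sum fun n _ => pow_le_pow_left₀ (norm_nonneg _) (norm_coef_le f n) 2).trans
    (schur_tsum f t)

lemma memℓp_coef (f : H20) : Memℓp (coef f) 2 :=
  memℓp_gen' (C := (Real.pi * ‖f‖) ^ 2) fun t => by simpa using sum_coef_le f t

/-- The bounded operator given by the multiplicative Hilbert matrix; it is only used to show that
the integral operator below is well defined. -/
def matrixOp : H20 →L[ℂ] H20 :=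
  LinearMap.mkContinuous
    { toFun := fun f => ⟨coef f, memℓp_coef f⟩
      map_add' := fun f g => by
        ext n
        simp only [coef, lp.coeFn_add, Pi.add_apply, mul_add]
        exact (summable_coef f n).tsum_add (summable_coef g n)
      map_smul' := fun c f => by
        ext n
        simp only [coef, lp.coeFn_smul, Pi.smul_apply, smul_eq_mul, RingHom.id_apply]
        rw [← tsum_mul_left]
        exact tsum_congr fun m => by ring }
    Real.pi fun f => by
      refine lp.norm_le_of_forall_sum_le (by norm_num) (by positivity) fun t => ?_
      simpa using sum_coef_le f t

lemma matrixOp_apply (f : H20) (n : Idx) : matrixOp f n = coef f n := rfl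


lemma summable_rpow {σ : ℝ} (hσ : 1 < σ) : Summable fun n : Idx => (((n : ℕ) : ℝ)) ^ (-σ) :=
  (Real.summable_nat_rpow.2 (by linarith)).comp_injective Subtype.val_injective

lemma norm_pow (n : Idx) (s : ℂ) : ‖((n : ℕ) : ℂ) ^ (-s)‖ = ((n : ℕ) : ℝ) ^ (-s.re) := by
  rw [Complex.norm_natCast_cpow_of_pos (by have := n.2; omega), Complex.neg_re]

lemma sq_rpow (n : Idx) (σ : ℝ) : (((n : ℕ) : ℝ) ^ (-σ)) ^ 2 = ((n : ℕ) : ℝ) ^ (-(2 * σ)) := by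
  rw [← Real.rpow_natCast, ← Real.rpow_mul (cast_pos n).le]
  congr 1; push_cast; ring

lemma summable_of_sq {x : Idx → ℝ} (hx : ∀ n, 0 ≤ x n) (hx2 : Summable fun n => x n ^ 2)
    {σ : ℝ} (hσ : 1 / 2 < σ) : Summable fun n => x n * ((n : ℕ) : ℝ) ^ (-σ) := by
  refine Summable.of_nonneg_of_le
    (fun n => mul_nonneg (hx n) (Real.rpow_nonneg (cast_pos n).le _)) (fun n => ?_)
    (hx2.add (summable_rpow (σ := 2 * σ) (by linarith)))
  rw [← sq_rpow]
  nlinarith [sq_nonneg (x n - ((n : ℕ) : ℝ) ^ (-σ)), sq_nonneg (x n),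
    sq_nonneg (((n : ℕ) : ℝ) ^ (-σ))]

lemma summable_norm_sq (f : H20) : Summable fun n => ‖f n‖ ^ 2 :=
  summable_of_sum_le (fun _ => sq_nonneg _) (sum_sq_le f)

lemma summable_norm_eval (f : H20) {s : ℂ} (hs : 1 / 2 < s.re) :
    Summable fun n : Idx => ‖f n * ((n : ℕ) : ℂ) ^ (-s)‖ := by
  simp_rw [norm_mul, norm_pow]
  exact summable_of_sq (fun n => norm_nonneg _) (summable_norm_sq f) hs

lemma summable_norm_pow {s : ℂ} (hs : 1 < s.re) :
    Summable fun n : Idx => ‖((n : ℕ) : ℂ) ^ (-s)‖ := by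
  simp_rw [norm_pow]
  exact summable_rpow hs

lemma zeta_sub_one {s : ℂ} (hs : 1 < s.re) :
    riemannZeta s - 1 = ∑' n : Idx, ((n : ℕ) : ℂ) ^ (-s) := by
  have h0 : Summable fun n : ℕ => 1 / (n : ℂ) ^ s := Complex.summable_one_div_nat_cpow.2 hs
  rw [zeta_eq_tsum_one_div_nat_cpow hs, ← h0.sum_add_tsum_nat_add 2]
  have hs0 : s ≠ 0 := Complex.ne_zero_of_one_lt_re hs
  simp only [Finset.sum_range_succ, Finset.sum_range_zero, Nat.cast_zero, Nat.cast_one,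
    Complex.zero_cpow hs0, Complex.one_cpow]
  simp only [div_zero, zero_add, div_one, add_sub_cancel_left]
  let e : ℕ ≃ Idx :=
    { toFun := fun n => ⟨n + 2, by omega⟩
      invFun := fun n => (n : ℕ) - 2
      left_inv := fun n => by simp
      right_inv := fun n => by
        apply Subtype.ext
        have := n.2
        simp only
        omega }
  rw [← e.tsum_eq]
  refine tsum_congr fun n => ?_
  rw [Complex.cpow_neg, one_div]
  rfl

/-- The terms of the double series for `f(w) (ζ(w + s) - 1)`. -/
def prodTerm (f : H20) (s : ℂ) (p : Idx × Idx) (w : ℝ) : ℂ :=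
  (f p.2 * ((p.2 : ℕ) : ℂ) ^ (-(w : ℂ))) * ((p.1 : ℕ) : ℂ) ^ (-((w : ℂ) + s))

lemma prodTerm_eq (f : H20) (s : ℂ) (p : Idx × Idx) (w : ℝ) :
    prodTerm f s p w = f p.2 * ((p.1 : ℕ) : ℂ) ^ (-s) *
      ((Real.exp (-Real.log ((p.2 : ℕ) * (p.1 : ℕ)) * w) : ℝ) : ℂ) := by
  have h1 : ((p.1 : ℕ) : ℂ) ≠ 0 := by exact_mod_cast (cast_pos p.1).ne'
  have h2 : ((p.2 : ℕ) : ℂ) ≠ 0 := by exact_mod_cast (cast_pos p.2).ne'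
  rw [prodTerm, neg_add, Complex.cpow_add _ _ h1, log_mul', Complex.cpow_def_of_ne_zero h2,
    Complex.cpow_def_of_ne_zero h1 (-(w : ℂ)), Complex.natCast_log.symm, Complex.natCast_log.symm]
  push_cast
  rw [neg_add, add_mul, Complex.exp_add]
  ring_nf

lemma log_mul_pos (m n : Idx) : 0 < Real.log ((m : ℕ) * (n : ℕ)) := by
  rw [log_mul']; exact add_pos (log_pos m) (log_pos n)

lemma integral_exp_ker (m n : Idx) :
    ∫ w in Ioi (1 / 2 : ℝ), Real.exp (-Real.log ((m : ℕ) * (n : ℕ)) * w) = ker m n := by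
  have h := log_mul_pos m n
  have hp : (0 : ℝ) < (m : ℕ) * (n : ℕ) := mul_pos (cast_pos m) (cast_pos n)
  rw [integral_exp_mul_Ioi (by linarith), ker, Real.sqrt_eq_rpow, Real.rpow_def_of_pos hp,
    neg_mul, Real.exp_neg]
  field_simp

lemma integrable_exp_ker (m n : Idx) :
    IntegrableOn (fun w : ℝ => Real.exp (-Real.log ((m : ℕ) * (n : ℕ)) * w)) (Ioi (1 / 2 : ℝ)) :=
  integrableOn_exp_mul_Ioi (by have := log_mul_pos m n; linarith) _

lemma integrable_term (f : H20) (s : ℂ) (p : Idx × Idx) :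
    IntegrableOn (prodTerm f s p) (Ioi (1 / 2 : ℝ)) := by
  have : prodTerm f s p = fun w => f p.2 * ((p.1 : ℕ) : ℂ) ^ (-s) *
      ((Real.exp (-Real.log ((p.2 : ℕ) * (p.1 : ℕ)) * w) : ℝ) : ℂ) := funext (prodTerm_eq f s p)
  rw [this]
  exact (integrable_exp_ker p.2 p.1).ofReal.const_mul _

lemma integral_term (f : H20) (s : ℂ) (p : Idx × Idx) :
    ∫ w in Ioi (1 / 2 : ℝ), prodTerm f s p w =
      (ker p.2 p.1 : ℂ) * f p.2 * ((p.1 : ℕ) : ℂ) ^ (-s) := by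
  simp_rw [prodTerm_eq]
  rw [integral_const_mul, integral_complex_ofReal, integral_exp_ker]
  ring

lemma integral_norm_term (f : H20) (s : ℂ) (p : Idx × Idx) :
    ∫ w in Ioi (1 / 2 : ℝ), ‖prodTerm f s p w‖ =
      (ker p.2 p.1 * ‖f p.2‖) * ((p.1 : ℕ) : ℝ) ^ (-s.re) := by
  simp_rw [prodTerm_eq, norm_mul, norm_pow, Complex.norm_real, Real.norm_of_nonneg (Real.exp_pos _).le]
  rw [integral_const_mul, integral_exp_ker]
  ring

lemma summable_integral_norm (f : H20) {s : ℂ} (hs : 1 / 2 < s.re) :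
    Summable fun p : Idx × Idx => ∫ w in Ioi (1 / 2 : ℝ), ‖prodTerm f s p w‖ := by
  simp_rw [integral_norm_term]
  rw [summable_prod_of_nonneg]
  · dsimp only
    simp_rw [tsum_mul_right]
    refine ⟨fun n => (summable_ker f n).mul_right (((n : ℕ) : ℝ) ^ (-s.re)), ?_⟩
    refine summable_of_sq (fun n => tsum_nonneg fun m =>
      mul_nonneg (ker_pos m n).le (norm_nonneg _)) ?_ hs
    exact summable_of_sum_le (fun _ => sq_nonneg _) (schur_tsum f)
  · intro p
    exact mul_nonneg (mul_nonneg (ker_pos _ _).le (norm_nonneg _))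
      (Real.rpow_nonneg (cast_pos _).le _)

lemma hasSum_mul_swap {A B : Idx → ℂ} (hA : Summable fun n => ‖A n‖)
    (hB : Summable fun n => ‖B n‖) :
    HasSum (fun p : Idx × Idx => A p.2 * B p.1) ((∑' n, A n) * ∑' n, B n) := by
  have h := (summable_mul_of_summable_norm hB hA).hasSum
  rw [← tsum_mul_tsum_of_summable_norm hB hA, mul_comm] at h
  simpa only [mul_comm] using h

lemma hasSum_term (f : H20) {s : ℂ} (hs : 1 / 2 < s.re) {w : ℝ} (hw : 1 / 2 < w) :
    HasSum (fun p => prodTerm f s p w) (eval f w * (riemannZeta ((w : ℂ) + s) - 1)) := by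
  have h1 := summable_norm_eval f (s := (w : ℂ)) hw
  have hre : 1 < ((w : ℂ) + s).re := by
    rw [Complex.add_re, Complex.ofReal_re]; linarith
  have h2 := summable_norm_pow hre
  have h3 := hasSum_mul_swap h1 h2
  rw [← zeta_sub_one hre] at h3
  unfold prodTerm eval
  exact h3

lemma integrable_tsum {F : Idx × Idx → ℝ → ℂ} {g : ℝ → ℂ} {μ : Measure ℝ}
    (hF : ∀ p, Integrable (F p) μ) (hs : Summable fun p => ∫ w, ‖F p w‖ ∂μ)
    (hg : ∀ᵐ w ∂μ, HasSum (fun p => F p w) (g w)) : Integrable g μ := by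
  refine ⟨aestronglyMeasurable_of_tendsto_ae Filter.atTop
    (f := fun t w => ∑ p ∈ t, F p w) (fun t => ?_) hg, ?_⟩
  · exact Finset.aestronglyMeasurable_fun_sum t fun p _ => (hF p).1
  · have h1 : ∀ᵐ w ∂μ, ‖g w‖ₑ ≤ ∑' p, ‖F p w‖ₑ := by
      filter_upwards [hg] with w hw
      exact hw.tsum_eq ▸ enorm_tsum_le_tsum_enorm
    refine lt_of_le_of_lt (lintegral_mono_ae h1) ?_
    rw [lintegral_tsum fun p => (hF p).1.enorm]
    have h2 : ∀ p, ∫⁻ w, ‖F p w‖ₑ ∂μ = ENNReal.ofReal (∫ w, ‖F p w‖ ∂μ) := fun p =>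
      (ofReal_integral_norm_eq_lintegral_enorm (hF p)).symm
    simp_rw [h2]
    rw [← ENNReal.ofReal_tsum_of_nonneg (fun p => integral_nonneg fun w => norm_nonneg _) hs]
    exact ENNReal.ofReal_lt_top

/-- The integral defining the operator converges absolutely. -/
lemma integrable_eval_mul_zeta (f : H20) {s : ℂ} (hs : 1 / 2 < s.re) :
    IntegrableOn (fun w : ℝ => eval f w * (riemannZeta ((w : ℂ) + s) - 1)) (Ioi (1 / 2 : ℝ)) :=
  integrable_tsum (integrable_term f s) (summable_integral_norm f hs)
    ((ae_restrict_iff' measurableSet_Ioi).2 (Filter.Eventually.of_forall fun _ hw =>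
      hasSum_term f hs hw))

lemma eval_matrixOp (f : H20) {s : ℂ} (hs : 1 / 2 < s.re) :
    eval (matrixOp f) s =
      ∫ w in Ioi (1 / 2 : ℝ), eval f w * (riemannZeta ((w : ℂ) + s) - 1) := by
  have h := hasSum_integral_of_summable_integral_norm (integrable_term f s)
    (summable_integral_norm f hs)
  rw [setIntegral_congr_fun measurableSet_Ioi
    (g := fun w : ℝ => eval f w * (riemannZeta ((w : ℂ) + s) - 1))
    (fun w hw => (hasSum_term f hs hw).tsum_eq)] at h
  rw [← h.tsum_eq, h.summable.tsum_prod]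
  refine tsum_congr fun n => ?_
  simp_rw [integral_term]
  rw [tsum_mul_right]
  rfl

/-- The coefficients of `f` as a sequence on all of `ℕ`. -/
def coeffSeq (f : H20) (n : ℕ) : ℂ := if h : 2 ≤ n then f ⟨n, h⟩ else 0

lemma LSeries_term_coeffSeq (f : H20) (s : ℂ) : LSeries.term (coeffSeq f) s =
    Function.extend (Subtype.val : Idx → ℕ) (fun n : Idx => f n * ((n : ℕ) : ℂ) ^ (-s)) 0 := by
  funext n
  by_cases h : 2 ≤ n
  · have := Subtype.val_injective.extend_apply
      (fun n : Idx => f n * ((n : ℕ) : ℂ) ^ (-s)) 0 (⟨n, h⟩ : Idx)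
    rw [this, LSeries.term_of_ne_zero (by omega), coeffSeq, dif_pos h, Complex.cpow_neg, div_eq_mul_inv]
  · rw [Function.extend_apply' _ _ _ (by rintro ⟨a, rfl⟩; exact h a.2)]
    rcases eq_or_ne n 0 with rfl | h0
    · simp
    · simp [LSeries.term_of_ne_zero h0, coeffSeq, h]

lemma LSeries_coeffSeq (f : H20) (s : ℂ) : LSeries (coeffSeq f) s = eval f s := by
  rw [LSeries, LSeries_term_coeffSeq, eval, tsum_extend_zero Subtype.val_injective]

lemma abscissa_coeffSeq (f : H20) : LSeries.abscissaOfAbsConv (coeffSeq f) < ⊤ := by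
  have h : LSeriesSummable (coeffSeq f) 1 := by
    rw [LSeriesSummable, LSeries_term_coeffSeq, summable_extend_zero Subtype.val_injective]
    exact (summable_norm_eval f (by norm_num)).of_norm
  exact h.abscissaOfAbsConv_le.trans_lt (by simpa using EReal.coe_lt_top 1)

lemma eval_injective {f g : H20} (h : ∀ s : ℂ, 1 / 2 < s.re → eval f s = eval g s) : f = g := by
  ext n
  have := LSeries.eq_of_LSeries_eventually_eq (abscissa_coeffSeq f) (abscissa_coeffSeq g) (by
    filter_upwards [Filter.eventually_gt_atTop (1 / 2 : ℝ)] with x hx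
    rw [LSeries_coeffSeq, LSeries_coeffSeq]
    exact h x (by simpa using hx)) (n := (n : ℕ)) (by have := n.2; omega)
  simpa [coeffSeq, n.2] using this

lemma memℓp_symbol :
    Memℓp (fun n : Idx => ((1 / (√(n : ℕ) * Real.log (n : ℕ)) : ℝ) : ℂ)) 2 := by
  let two : Idx := ⟨2, le_rfl⟩
  have h := schur_tsum (lp.single 2 two (1 : ℂ))
  have hs : ∀ n, ∑' m, ker m n * ‖(lp.single 2 two (1 : ℂ) : H20) m‖ = ker two n := by
    intro n
    rw [tsum_eq_single two]
    · simp
    · intro m hm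
      simp [hm]
  simp_rw [hs] at h
  refine memℓp_gen (Summable.of_nonneg_of_le (fun n => by positivity) (fun n => ?_)
    ((summable_of_sum_le (fun _ => sq_nonneg _) h).mul_left 8))
  have hn := cast_pos n
  have hl := log_pos n
  have h2 : Real.log 2 ≤ Real.log (n : ℕ) :=
    Real.log_le_log (by norm_num) (by exact_mod_cast n.2)
  have h3 : 0 < Real.log 2 := Real.log_pos (by norm_num)
  rw [ker, log_mul', Complex.norm_real, Real.norm_of_nonneg (by positivity)]
  simp only [ENNReal.toReal_ofNat, Real.rpow_ofNat, two, Nat.cast_ofNat]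
  rw [div_pow, div_pow, mul_pow, mul_pow, Real.sq_sqrt hn.le, Real.sq_sqrt (by positivity),
    one_pow, mul_one_div, div_le_div_iff₀ (by positivity) (by positivity)]
  have : (Real.log 2 + Real.log (n : ℕ)) ^ 2 ≤ (2 * Real.log (n : ℕ)) ^ 2 := by
    gcongr; linarith
  nlinarith

/-- There is exactly one bounded operator `H` on the space with
`(H f)(s) = ∫_{1/2}^∞ f(w) (ζ(w + s) - 1) dw` for all `f` and all `s` with `1/2 < Re s`. -/
theorem existsUnique_hilbertOp : ∃! H : H20 →L[ℂ] H20, ∀ (f : H20) (s : ℂ), 1 / 2 < s.re →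
    eval (H f) s = ∫ w in Ioi (1 / 2 : ℝ), eval f w * (riemannZeta ((w : ℂ) + s) - 1) := by
  refine ⟨matrixOp, fun f s hs => eval_matrixOp f hs, fun T hT => ?_⟩
  refine ContinuousLinearMap.ext fun f => eval_injective fun s hs => ?_
  rw [hT f s hs, eval_matrixOp f hs]

/-- The integral operator `H f(s) = ∫_{1/2}^∞ f(w) (ζ(w + s) - 1) dw`, acting on the space of
Dirichlet series. -/
def hilbertOp : H20 →L[ℂ] H20 := existsUnique_hilbertOp.exists.choose

theorem eval_hilbertOp (f : H20) {s : ℂ} (hs : 1 / 2 < s.re) :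
    eval (hilbertOp f) s =
      ∫ w in Ioi (1 / 2 : ℝ), eval f w * (riemannZeta ((w : ℂ) + s) - 1) :=
  existsUnique_hilbertOp.exists.choose_spec f s hs

theorem hilbertOp_eq_matrixOp : hilbertOp = matrixOp :=
  existsUnique_hilbertOp.unique existsUnique_hilbertOp.exists.choose_spec
    fun f _ hs => eval_matrixOp f hs

/-- The analytic symbol `ψ(s) = ∑_{n ≥ 2} n^{-s} / (√n log n)`. -/
def symbol : H20 :=
  ⟨fun n : Idx => ((1 / (√(n : ℕ) * Real.log (n : ℕ)) : ℝ) : ℂ), memℓp_symbol⟩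

/-- The point spectrum: the set of eigenvalues. -/
def pointSpectrum (T : H20 →L[ℂ] H20) : Set ℂ := {μ | ∃ f : H20, f ≠ 0 ∧ T f = μ • f}

/-- The continuous spectrum: all `μ` for which `T - μ` is injective with dense range, but not
surjective. -/
def continuousSpectrum (T : H20 →L[ℂ] H20) : Set ℂ :=
  {μ | Function.Injective (fun f => T f - μ • f) ∧ DenseRange (fun f => T f - μ • f) ∧
    ¬ Function.Surjective (fun f => T f - μ • f)}

end MulHilbert

end

noncomputable section

namespace MulHilbert

open Set MeasureTheory Filter Topology ComplexConjugate InnerProductSpace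

/-! Write n = i + 2 and α_i = a_n / √n. Multiplying (H - λ)f = cψ by √n turns it into λ n α_i =
Φ(log n) - c / log n, where Φ(y) = ∑ α_j / (log(j + 2) + y) is `cauchySum α`. The aim is to force α
= 0 and c = 0 for every λ in (0, π]; the endpoint π needs no separate argument.

Let B(s) = ∑ α_i (log n)^(s - 1) be `lgSeries α`. Since ∑ n |α_i|² is finite, B converges for 0 ≤ Re
s < 1/2 and grows at most like (1/2 - Re s)^(-1/2). The Mellin transform of Φ is B(s) π / sin πs
(`mellin_cauchySum`). On the other hand λB(s) samples (Φ(y) - c/y) y^(s - 1) at y = log n with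
weights 1/n, so it differs from an integral by an error analytic in 0 < Re s < 2. Comparing the two
gives (λ sin πs - π) B = analytic (`exists_lgSeries_equation`). For λ ≤ π the factor vanishes in the
strip only on Re s = 1/2, where the slow growth of B excludes poles. Hence B continues to 0 < Re s <
2, with value c at 1 (`exists_lgSeries_extension`).

Mellin inversion and a shift of the line from Re s = 1/4 to 5/4 yield Φ(y) - c/(1 + y) = O(y^(-5/4))
(`exists_norm_cauchySum_sub_le`). The equation then makes ∑ |α_i| finite, and ∑ α_i = lim y Φ(y) =
c. Finally d_i/(d_i + d_j) + d_j/(d_i + d_j) = 1 for d_i = log n implies -2λ ∑ n log n |α_i|² =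
|c|², so both sides vanish (`eq_zero_of_cauchySum_equation`).

For λ = 0 the same identity, iterated, makes all the moments ∑ α_i d_i^(-k), k ≥ 1, vanish
(`eq_zero_of_cauchySum_eq_zero`). The matrix is self-adjoint, positive and of norm at most π, so the
spectrum lies in [0, π]. Each λ in (0, π] belongs to it because ψ is not in the range of H - λ, and
0 belongs to it because the spectrum is closed. Dense range is injectivity of a self-adjoint
operator. -/

/-- The numbers `log 2, log 3, …`. -/
def lg (i : ℕ) : ℝ := Real.log ((i : ℝ) + 2)

/-! ### Spacing of the points log n and sums over them -/

lemma half_le_lg (i : ℕ) : 1 / 2 ≤ lg i := by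
  have h1 : Real.log 2 ≤ lg i := Real.log_le_log (by norm_num) (by linarith [Nat.cast_nonneg (α := ℝ) i])
  linarith [Real.log_two_gt_d9]

lemma lg_pos (i : ℕ) : 0 < lg i := by linarith [half_le_lg i]

lemma lg_succ_sub_le (i : ℕ) : lg (i + 1) - lg i ≤ 1 / (i + 2 : ℝ) := by
  have hi : (0 : ℝ) ≤ i := Nat.cast_nonneg i
  have h := Real.log_le_sub_one_of_pos (x := ((i : ℝ) + 3) / (i + 2)) (by positivity)
  rw [Real.log_div (by positivity) (by positivity)] at h
  unfold lg
  push_cast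
  rw [show (i : ℝ) + 1 + 2 = i + 3 by ring]
  refine h.trans (le_of_eq ?_)
  field_simp
  ring

lemma le_lg_succ_sub (i : ℕ) : 1 / (i + 3 : ℝ) ≤ lg (i + 1) - lg i := by
  have hi : (0 : ℝ) ≤ i := Nat.cast_nonneg i
  have h := Real.one_sub_inv_le_log_of_pos (x := ((i : ℝ) + 3) / (i + 2)) (by positivity)
  rw [Real.log_div (by positivity) (by positivity)] at h
  unfold lg
  push_cast
  rw [show (i : ℝ) + 1 + 2 = i + 3 by ring]
  refine le_trans (le_of_eq ?_) h
  field_simp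
  ring

lemma lg_lt_succ (i : ℕ) : lg i < lg (i + 1) := by
  have := le_lg_succ_sub i
  have : (0 : ℝ) < 1 / (i + 3 : ℝ) := by positivity
  linarith

lemma strictMono_lg : StrictMono lg := strictMono_nat_of_lt_succ lg_lt_succ

lemma tendsto_lg : Tendsto lg atTop atTop :=
  Real.tendsto_log_atTop.comp (tendsto_atTop_add_const_right _ _ tendsto_natCast_atTop_atTop)

/-- The sum is compared with the telescoping sum of lg^(-q) / q, a discrete form of ∫ y^(-1-q) dy.
The order 1/q of the bound as q → 0 is what later limits the growth of the series near Re s = 1/2.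
-/
lemma sum_inv_lg_rpow_le {q : ℝ} (hq : 0 < q) (hq1 : q ≤ 1) (N : ℕ) :
    ∑ i ∈ Finset.range N, 1 / ((i + 2 : ℝ) * lg i ^ (1 + q)) ≤ 4 / q := by
  have key : ∀ i : ℕ, 1 / (((i + 1 : ℕ) + 2 : ℝ) * lg (i + 1) ^ (1 + q)) ≤
      lg i ^ (-q) / q - lg (i + 1) ^ (-q) / q := by
    intro i
    have h1 := lg_pos i
    have h2 := lg_pos (i + 1)
    have h3 := le_lg_succ_sub i
    -- Bernoulli's inequality for the exponent -q, from e^x ≥ 1 + x and log t ≤ t - 1.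
    have h4 : 1 + q * (1 - lg i / lg (i + 1)) ≤ (lg i / lg (i + 1)) ^ (-q) := by
      have ht : 0 < lg i / lg (i + 1) := by positivity
      rw [Real.rpow_def_of_pos ht]
      have := Real.log_le_sub_one_of_pos ht
      nlinarith [Real.add_one_le_exp (Real.log (lg i / lg (i + 1)) * -q)]
    rw [Real.div_rpow h1.le h2.le] at h4
    have h5 : 0 < lg (i + 1) ^ (-q) := Real.rpow_pos_of_pos h2 _
    rw [le_div_iff₀ h5] at h4
    have h6 : lg (i + 1) ^ (1 + q) = lg (i + 1) / lg (i + 1) ^ (-q) := by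
      rw [Real.rpow_add h2, Real.rpow_one, Real.rpow_neg h2.le]; field_simp
    rw [h6, ← sub_div, le_div_iff₀ hq]
    calc 1 / (((i + 1 : ℕ) + 2 : ℝ) * (lg (i + 1) / lg (i + 1) ^ (-q))) * q
        = (1 / (i + 3 : ℝ)) * (q * lg (i + 1) ^ (-q) / lg (i + 1)) := by
          push_cast
          rw [show (i : ℝ) + 1 + 2 = i + 3 by ring]
          field_simp
      _ ≤ (lg (i + 1) - lg i) * (q * lg (i + 1) ^ (-q) / lg (i + 1)) := by gcongr
      _ = q * (1 - lg i / lg (i + 1)) * lg (i + 1) ^ (-q) := by field_simp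
      _ ≤ _ := by linarith
  have hl0 := half_le_lg 0
  have hl := lg_pos 0
  rcases N with _ | N
  · simp only [Finset.range_zero, Finset.sum_empty]; positivity
  rw [Finset.sum_range_succ']
  have h7 := (Finset.sum_le_sum fun i (_ : i ∈ Finset.range N) => key i)
  rw [Finset.sum_range_sub'] at h7
  have h8 : 0 ≤ lg N ^ (-q) / q := div_nonneg (Real.rpow_nonneg (lg_pos N).le _) hq.le
  have h9 : lg 0 ^ (-q) ≤ 2 := by
    calc lg 0 ^ (-q) ≤ (1 / 2 : ℝ) ^ (-q) :=
          Real.rpow_le_rpow_of_nonpos (by norm_num) hl0 (by linarith)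
      _ ≤ (1 / 2 : ℝ) ^ (-1 : ℝ) :=
          Real.rpow_le_rpow_of_exponent_ge (by norm_num) (by norm_num) (by linarith)
      _ = 2 := by rw [Real.rpow_neg_one]; norm_num
  -- The term i = 0 has no predecessor to telescope against; it costs a second 2 / q.
  have h10 : 1 / (((0 : ℕ) + 2 : ℝ) * lg 0 ^ (1 + q)) ≤ 2 / q := by
    rw [Real.rpow_add hl, Real.rpow_one]
    have e : lg 0 ^ q = (lg 0 ^ (-q))⁻¹ := by rw [Real.rpow_neg hl.le, inv_inv]
    rw [e]
    calc 1 / (((0 : ℕ) + 2 : ℝ) * (lg 0 * (lg 0 ^ (-q))⁻¹)) = lg 0 ^ (-q) / (2 * lg 0) := by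
          push_cast; rw [zero_add]; field_simp
      _ ≤ 2 / 1 := by gcongr; linarith
      _ ≤ 2 / q := by gcongr
  have h11 : lg 0 ^ (-q) / q ≤ 2 / q := by gcongr
  have : 4 / q = 2 / q + 2 / q := by ring
  linarith

/-! ### Convergence of ∑ α_i (log n)^(s - 1) to the left of Re s = 1/2 -/

section Weights

variable {α : ℕ → ℂ}

/-- Cauchy–Schwarz against the weights 1 / (n (log n)^(2 - 2σ)), summed with q = 1 - 2σ. -/
lemma sum_norm_mul_lg_rpow_sq_le (hα : Summable fun i : ℕ => (i + 2 : ℝ) * ‖α i‖ ^ 2) {σ : ℝ}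
    (h0 : 0 ≤ σ) (h1 : σ < 1 / 2) (s : Finset ℕ) :
    (∑ i ∈ s, ‖α i‖ * lg i ^ (σ - 1)) ^ 2 ≤
      (∑' i : ℕ, (i + 2 : ℝ) * ‖α i‖ ^ 2) * (4 / (1 - 2 * σ)) := by
  have h2 := Finset.sum_sq_le_sum_mul_sum_of_sq_le_mul s
    (r := fun i => ‖α i‖ * lg i ^ (σ - 1)) (f := fun i : ℕ => (i + 2 : ℝ) * ‖α i‖ ^ 2)
    (g := fun i : ℕ => 1 / ((i + 2 : ℝ) * lg i ^ (1 + (1 - 2 * σ))))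
    (fun i _ => by positivity)
    (fun i _ => by have := Real.rpow_nonneg (lg_pos i).le (1 + (1 - 2 * σ)); positivity)
    (fun i _ => by
      have h := lg_pos i
      have e : lg i ^ (1 + (1 - 2 * σ)) = ((lg i ^ (σ - 1)) ^ 2)⁻¹ := by
        rw [← Real.rpow_natCast, ← Real.rpow_mul h.le, ← Real.rpow_neg h.le]
        congr 1; push_cast; ring
      rw [e]
      have := Real.rpow_pos_of_pos h (σ - 1)
      apply le_of_eq
      field_simp)
  refine h2.trans ?_
  obtain ⟨N, hN⟩ := s.exists_nat_subset_range
  have h3 : ∑ i ∈ s, 1 / ((i + 2 : ℝ) * lg i ^ (1 + (1 - 2 * σ))) ≤ 4 / (1 - 2 * σ) :=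
    (Finset.sum_le_sum_of_subset_of_nonneg hN fun i _ _ => by
      have := Real.rpow_nonneg (lg_pos i).le (1 + (1 - 2 * σ)); positivity).trans
      (sum_inv_lg_rpow_le (by linarith) (by linarith) N)
  have h4 : ∑ i ∈ s, (i + 2 : ℝ) * ‖α i‖ ^ 2 ≤ ∑' i : ℕ, (i + 2 : ℝ) * ‖α i‖ ^ 2 :=
    hα.sum_le_tsum s fun i _ => by positivity
  have h5 : 0 ≤ ∑ i ∈ s, (i + 2 : ℝ) * ‖α i‖ ^ 2 := Finset.sum_nonneg fun i _ => by positivity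
  have h6 : 0 ≤ 4 / (1 - 2 * σ) := by have : 0 < 1 - 2 * σ := by linarith
                                      positivity
  refine mul_le_mul h4 h3 (Finset.sum_nonneg fun i _ => ?_) (h5.trans h4)
  have := Real.rpow_nonneg (lg_pos i).le (1 + (1 - 2 * σ))
  positivity

lemma summable_norm_mul_lg_rpow (hα : Summable fun i : ℕ => (i + 2 : ℝ) * ‖α i‖ ^ 2) {σ : ℝ}
    (h0 : 0 ≤ σ) (h1 : σ < 1 / 2) : Summable fun i => ‖α i‖ * lg i ^ (σ - 1) :=
  summable_of_sum_le
    (fun i => mul_nonneg (norm_nonneg _) (Real.rpow_nonneg (lg_pos i).le _))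
    fun s => Real.le_sqrt_of_sq_le (sum_norm_mul_lg_rpow_sq_le hα h0 h1 s)

lemma tsum_norm_mul_lg_rpow_sq_le (hα : Summable fun i : ℕ => (i + 2 : ℝ) * ‖α i‖ ^ 2) {σ : ℝ}
    (h0 : 0 ≤ σ) (h1 : σ < 1 / 2) :
    (∑' i, ‖α i‖ * lg i ^ (σ - 1)) ^ 2 ≤
      (∑' i : ℕ, (i + 2 : ℝ) * ‖α i‖ ^ 2) * (4 / (1 - 2 * σ)) :=
  le_of_tendsto ((summable_norm_mul_lg_rpow hα h0 h1).hasSum.pow 2)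
    (Eventually.of_forall fun s => sum_norm_mul_lg_rpow_sq_le hα h0 h1 s)

lemma summable_norm_div_lg (hα : Summable fun i : ℕ => (i + 2 : ℝ) * ‖α i‖ ^ 2) :
    Summable fun i => ‖α i‖ / lg i := by
  have := summable_norm_mul_lg_rpow hα le_rfl (by norm_num)
  simpa only [zero_sub, Real.rpow_neg_one, ← div_eq_mul_inv] using this

end Weights

/-! ### Mellin transforms of 1 / (d + t) -/

/-- The Mellin transform of `1 / (1 + t)` converges in the strip `0 < Re s < 1`. -/
lemma mellinConvergent_inv_one_add {s : ℂ} (h0 : 0 < s.re) (h1 : s.re < 1) :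
    MellinConvergent (fun t : ℝ => ((1 + t : ℝ) : ℂ)⁻¹) s := by
  refine mellinConvergent_of_isBigO_rpow (a := 1) (b := 0) ?_ ?_ h1 ?_ h0
  · refine ContinuousOn.locallyIntegrableOn ?_ measurableSet_Ioi
    refine ContinuousOn.inv₀ (by fun_prop) fun t (ht : 0 < t) => ?_
    exact_mod_cast (by positivity : (1 + t : ℝ) ≠ 0)
  · refine Asymptotics.IsBigO.of_bound 1 ?_
    filter_upwards [eventually_gt_atTop 0] with t ht
    rw [norm_inv, Complex.norm_real, Real.rpow_neg_one, norm_inv, one_mul,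
      Real.norm_of_nonneg (by positivity), Real.norm_of_nonneg ht.le]
    gcongr
    linarith
  · refine Asymptotics.IsBigO.of_bound 1 ?_
    filter_upwards [self_mem_nhdsWithin] with t ht
    have ht : 0 < t := ht
    rw [norm_inv, Complex.norm_real, neg_zero, Real.rpow_zero, norm_one, one_mul,
      Real.norm_of_nonneg (by positivity)]
    exact inv_le_one_of_one_le₀ (by linarith)

/-- The Mellin transform of `1 / (1 + t)`. -/
lemma mellin_inv_one_add {s : ℂ} (h0 : 0 < s.re) (h1 : s.re < 1) :
    mellin (fun t : ℝ => ((1 + t : ℝ) : ℂ)⁻¹) s = Real.pi / Complex.sin (Real.pi * s) := by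
  have hβ := Complex.Gamma_mul_Gamma_eq_betaIntegral (s := s) (t := 1 - s) h0 (by simpa using h1)
  rw [Complex.Gamma_mul_Gamma_one_sub, add_sub_cancel, Complex.Gamma_one, one_mul] at hβ
  rw [hβ, Complex.betaIntegral, intervalIntegral.integral_of_le zero_le_one,
    integral_Ioc_eq_integral_Ioo]
  -- The substitution x = t / (1 + t) carries the beta integral B(s, 1 - s) = Γ(s) Γ(1 - s) over (0,
  -- 1) to the Mellin integral over (0, ∞).
  have himg : (fun t : ℝ => t / (1 + t)) '' Ioi 0 = Ioo 0 1 := by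
    ext x
    constructor
    · rintro ⟨t, ht, rfl⟩
      have ht : 0 < t := ht
      exact ⟨by positivity, by rw [div_lt_one (by positivity)]; linarith⟩
    · rintro ⟨hx0, hx1⟩
      have : 0 < 1 - x := by linarith
      refine ⟨x / (1 - x), div_pos hx0 this, ?_⟩
      field_simp
      ring
  have hinj : InjOn (fun t : ℝ => t / (1 + t)) (Ioi 0) := by
    intro a ha b hb hab
    have ha : 0 < a := ha
    have hb : 0 < b := hb
    simp only at hab
    rw [div_eq_div_iff (by positivity) (by positivity)] at hab
    linarith
  have hder : ∀ t ∈ Ioi (0 : ℝ), HasDerivWithinAt (fun t : ℝ => t / (1 + t))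
      (1 / (1 + t) ^ 2) (Ioi 0) t := by
    intro t ht
    have ht : 0 < t := ht
    have h := (hasDerivAt_id t).div ((hasDerivAt_id t).const_add 1) (by simp; positivity)
    refine (h.congr_deriv ?_).hasDerivWithinAt
    simp
  rw [← himg, integral_image_eq_integral_abs_deriv_smul measurableSet_Ioi hder hinj, mellin]
  refine setIntegral_congr_fun measurableSet_Ioi fun t ht => ?_
  have ht : 0 < t := ht
  have h1t : 0 < 1 + t := by positivity
  have hc : ((1 + t : ℝ) : ℂ) ≠ 0 := by exact_mod_cast h1t.ne'
  have e1 : ((t / (1 + t) : ℝ) : ℂ) ^ (s - 1) = (t : ℂ) ^ (s - 1) / ((1 + t : ℝ) : ℂ) ^ (s - 1) := by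
    rw [Complex.ofReal_div, Complex.div_cpow_ofReal_nonneg ht.le h1t.le]
  have e2 : (1 - ((t / (1 + t) : ℝ) : ℂ)) = ((1 + t : ℝ) : ℂ)⁻¹ := by
    rw [← Complex.ofReal_inv, ← Complex.ofReal_one, ← Complex.ofReal_sub]
    congr 1
    field_simp
    ring
  have e3 : (((1 + t : ℝ) : ℂ)⁻¹) ^ (1 - s - 1) = ((1 + t : ℝ) : ℂ) ^ s := by
    rw [Complex.inv_cpow _ _ (by rw [Complex.arg_ofReal_of_nonneg h1t.le]; exact Real.pi_pos.ne),
      ← Complex.cpow_neg]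
    congr 1; ring
  simp only [smul_eq_mul, Complex.real_smul]
  rw [e1, e2, e3, Complex.cpow_sub _ _ hc, Complex.cpow_one, abs_of_pos (by positivity)]
  have := (Complex.cpow_ne_zero_iff_of_exponent_ne_zero (x := ((1 + t : ℝ) : ℂ)) (y := s) (by
    rintro rfl; simp at h0)).2 hc
  push_cast at hc this ⊢
  field_simp

lemma inv_add_eq {d : ℝ} (hd : 0 < d) : (fun t : ℝ => ((d + t : ℝ) : ℂ)⁻¹) =
    fun t => (d : ℂ)⁻¹ • (fun t : ℝ => ((1 + t : ℝ) : ℂ)⁻¹) (d⁻¹ * t) := by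
  funext t
  have : (d : ℂ) ≠ 0 := by exact_mod_cast hd.ne'
  simp only [smul_eq_mul]
  rw [← mul_inv]
  congr 1
  push_cast
  field_simp

lemma mellinConvergent_inv_add {d : ℝ} (hd : 0 < d) {s : ℂ} (h0 : 0 < s.re) (h1 : s.re < 1) :
    MellinConvergent (fun t : ℝ => ((d + t : ℝ) : ℂ)⁻¹) s := by
  rw [inv_add_eq hd]
  exact ((MellinConvergent.comp_mul_left (inv_pos.2 hd)).2
    (mellinConvergent_inv_one_add h0 h1)).const_smul _

lemma mellin_inv_add {d : ℝ} (hd : 0 < d) {s : ℂ} (h0 : 0 < s.re) (h1 : s.re < 1) :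
    mellin (fun t : ℝ => ((d + t : ℝ) : ℂ)⁻¹) s =
      (d : ℂ) ^ (s - 1) * (Real.pi / Complex.sin (Real.pi * s)) := by
  have hc : (d : ℂ) ≠ 0 := by exact_mod_cast hd.ne'
  rw [inv_add_eq hd, mellin_const_smul,
    mellin_comp_mul_left (fun t : ℝ => ((1 + t : ℝ) : ℂ)⁻¹) _ (inv_pos.2 hd),
    mellin_inv_one_add h0 h1, smul_eq_mul, smul_eq_mul, ← mul_assoc]
  congr 1
  rw [Complex.ofReal_inv, Complex.inv_cpow _ _ (by
    rw [Complex.arg_ofReal_of_nonneg hd.le]; exact Real.pi_pos.ne), Complex.cpow_neg, inv_inv,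
    Complex.cpow_sub _ _ hc, Complex.cpow_one]
  ring

/-! ### The Cauchy sum and its Mellin transform -/

section

/-- The function `y ↦ ∑ α_i / (lg i + y)`. -/
def cauchySum (α : ℕ → ℂ) (y : ℝ) : ℂ := ∑' i, α i * ((lg i + y : ℝ) : ℂ)⁻¹

/-- The generalized Dirichlet series `s ↦ ∑ α_i (lg i)^(s - 1)`. -/
def lgSeries (α : ℕ → ℂ) (s : ℂ) : ℂ := ∑' i, α i * (lg i : ℂ) ^ (s - 1)

variable {α : ℕ → ℂ}

lemma norm_inv_lg_add {y : ℝ} (hy : 0 ≤ y) (i : ℕ) :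
    ‖(((lg i + y : ℝ) : ℂ))⁻¹‖ = (lg i + y)⁻¹ := by
  have := lg_pos i
  rw [norm_inv, Complex.norm_real, Real.norm_of_nonneg (by positivity)]

lemma norm_lg_cpow (i : ℕ) (s : ℂ) : ‖(lg i : ℂ) ^ (s - 1)‖ = lg i ^ (s.re - 1) := by
  rw [Complex.norm_cpow_eq_rpow_re_of_pos (lg_pos i), Complex.sub_re, Complex.one_re]

lemma norm_cauchyTerm_le {y : ℝ} (hy : 0 ≤ y) (i : ℕ) :
    ‖α i * ((lg i + y : ℝ) : ℂ)⁻¹‖ ≤ ‖α i‖ / lg i := by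
  have := lg_pos i
  rw [norm_mul, norm_inv_lg_add hy, div_eq_mul_inv]
  gcongr
  linarith

lemma summable_cauchyTerm (hα : Summable fun i => ‖α i‖ / lg i) {y : ℝ} (hy : 0 ≤ y) :
    Summable fun i => α i * ((lg i + y : ℝ) : ℂ)⁻¹ :=
  Summable.of_norm_bounded hα (norm_cauchyTerm_le hy)

lemma norm_cauchySum_le (hα : Summable fun i => ‖α i‖ / lg i) {y : ℝ} (hy : 0 ≤ y) :
    ‖cauchySum α y‖ ≤ ∑' i, ‖α i‖ / lg i :=
  tsum_of_norm_bounded hα.hasSum (norm_cauchyTerm_le hy)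

lemma norm_cauchySum_sub_le (hα : Summable fun i => ‖α i‖ / lg i) {x y : ℝ} (hx : 0 ≤ x)
    (hy : 0 ≤ y) :
    ‖cauchySum α x - cauchySum α y‖ ≤ 2 * (∑' i, ‖α i‖ / lg i) * |x - y| := by
  rw [cauchySum, cauchySum, ← (summable_cauchyTerm hα hx).tsum_sub (summable_cauchyTerm hα hy)]
  have h := (hα.hasSum.mul_left 2).mul_right |x - y|
  refine tsum_of_norm_bounded h fun i => ?_
  have h1 := lg_pos i
  have h2 := half_le_lg i
  have h3 : (((lg i + x : ℝ) : ℂ))⁻¹ - ((lg i + y : ℝ) : ℂ)⁻¹ =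
      (((y - x) * ((lg i + x)⁻¹ * (lg i + y)⁻¹) : ℝ) : ℂ) := by
    have h4 : lg i + x ≠ 0 := by positivity
    have h5 : lg i + y ≠ 0 := by positivity
    rw [← Complex.ofReal_inv, ← Complex.ofReal_inv, ← Complex.ofReal_sub]
    congr 1
    field_simp
    ring
  rw [← mul_sub, h3, norm_mul, Complex.norm_real, norm_mul, Real.norm_eq_abs, abs_sub_comm y x,
    Real.norm_of_nonneg (by positivity)]
  have h6 : (lg i + x)⁻¹ ≤ (lg i)⁻¹ := by gcongr; linarith
  have h7 : (lg i + y)⁻¹ ≤ 2 := by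
    rw [inv_le_comm₀ (by positivity) (by norm_num)]
    linarith
  calc ‖α i‖ * (|x - y| * ((lg i + x)⁻¹ * (lg i + y)⁻¹))
      ≤ ‖α i‖ * (|x - y| * ((lg i)⁻¹ * 2)) := by gcongr
    _ = _ := by ring

lemma continuousOn_cauchySum (hα : Summable fun i => ‖α i‖ / lg i) :
    ContinuousOn (cauchySum α) (Ici 0) :=
  (LipschitzOnWith.of_dist_le_mul (K := (2 * ∑' i, ‖α i‖ / lg i).toNNReal) fun x hx y hy => by
    rw [Real.coe_toNNReal _ (mul_nonneg two_pos.le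
      (tsum_nonneg fun i => div_nonneg (norm_nonneg _) (lg_pos i).le)), dist_eq_norm,
      Real.dist_eq]
    exact norm_cauchySum_sub_le hα hx hy).continuousOn

/-- In (d + y)^(-1) = (d + y)^(σ - 1) (d + y)^(-σ) the first factor is at most d^(σ - 1) and the
second at most y^(-σ). -/
lemma norm_cauchySum_le_rpow {σ : ℝ} (h0 : 0 ≤ σ) (h1 : σ ≤ 1)
    (hα : Summable fun i => ‖α i‖ * lg i ^ (σ - 1)) {y : ℝ} (hy : 0 < y) :
    ‖cauchySum α y‖ ≤ (∑' i, ‖α i‖ * lg i ^ (σ - 1)) * y ^ (-σ) := by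
  refine tsum_of_norm_bounded (hα.hasSum.mul_right _) fun i => ?_
  have hi := lg_pos i
  rw [norm_mul, norm_inv_lg_add hy.le, mul_assoc]
  gcongr
  have h2 : (lg i + y)⁻¹ = (lg i + y) ^ (σ - 1) * (lg i + y) ^ (-σ) := by
    rw [← Real.rpow_add (by positivity), ← Real.rpow_neg_one]
    congr 1; ring
  rw [h2]
  gcongr ?_ * ?_
  · exact Real.rpow_le_rpow_of_nonpos hi (by linarith) (by linarith)
  · exact Real.rpow_le_rpow_of_nonpos hy (by linarith) (by linarith)

lemma mellinConvergent_cauchySum (hα : Summable fun i : ℕ => (i + 2 : ℝ) * ‖α i‖ ^ 2) {s : ℂ}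
    (h0 : 0 < s.re) (h1 : s.re < 1 / 2) : MellinConvergent (cauchySum α) s := by
  have hK := summable_norm_div_lg hα
  obtain ⟨σ, hσ, hσ'⟩ := exists_between h1
  refine mellinConvergent_of_isBigO_rpow (a := σ) (b := 0) ?_ ?_ hσ ?_ h0
  · exact ((continuousOn_cauchySum hK).mono Ioi_subset_Ici_self).locallyIntegrableOn
      measurableSet_Ioi
  · refine Asymptotics.IsBigO.of_bound (∑' i, ‖α i‖ * lg i ^ (σ - 1)) ?_
    filter_upwards [eventually_gt_atTop 0] with y hy
    rw [Real.norm_of_nonneg (Real.rpow_nonneg hy.le _)]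
    exact norm_cauchySum_le_rpow (by linarith) (by linarith)
      (summable_norm_mul_lg_rpow hα (by linarith) hσ') hy
  · refine Asymptotics.IsBigO.of_bound (∑' i, ‖α i‖ / lg i) ?_
    filter_upwards [self_mem_nhdsWithin] with y hy
    rw [neg_zero, Real.rpow_zero, norm_one, mul_one]
    exact norm_cauchySum_le hK (le_of_lt hy)

lemma mellin_cauchySum (hα : Summable fun i : ℕ => (i + 2 : ℝ) * ‖α i‖ ^ 2) {s : ℂ}
    (h0 : 0 < s.re) (h1 : s.re < 1 / 2) :
    mellin (cauchySum α) s = lgSeries α s * (Real.pi / Complex.sin (Real.pi * s)) := by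
  have hK := summable_norm_div_lg hα
  set F : ℕ → ℝ → ℂ := fun i t => α i * ((t : ℂ) ^ (s - 1) • ((lg i + t : ℝ) : ℂ)⁻¹) with hF
  have hint : ∀ i, Integrable (F i) (volume.restrict (Ioi 0)) := fun i =>
    Integrable.const_mul (mellinConvergent_inv_add (lg_pos i) h0 (by linarith)) _
  have hval : ∀ i, ∫ t in Ioi 0, F i t =
      α i * (lg i : ℂ) ^ (s - 1) * (Real.pi / Complex.sin (Real.pi * s)) := fun i => by
    rw [integral_const_mul, mul_assoc, ← mellin_inv_add (lg_pos i) h0 (by linarith), mellin]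
  -- The norms of the terms integrate exactly: they form the same Mellin integral at the real point
  -- Re s. This justifies integrating term by term.
  have hnorm : ∀ i, ∫ t in Ioi 0, ‖F i t‖ = ‖α i‖ * lg i ^ (s.re - 1) *
      ‖(Real.pi : ℂ) / Complex.sin (Real.pi * (s.re : ℂ))‖ := fun i => by
    have h2 := mellin_inv_add (lg_pos i) (s := (s.re : ℂ)) (by simpa using h0)
      (by simp; linarith)
    have h3 : mellin (fun t : ℝ => ((lg i + t : ℝ) : ℂ)⁻¹) (s.re : ℂ) =
        ((∫ t in Ioi 0, t ^ (s.re - 1) * (lg i + t)⁻¹ : ℝ) : ℂ) := by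
      rw [mellin, ← integral_complex_ofReal]
      refine setIntegral_congr_fun measurableSet_Ioi fun t (ht : 0 < t) => ?_
      simp only [smul_eq_mul]
      rw [Complex.ofReal_mul, Complex.ofReal_cpow ht.le]
      push_cast
      rfl
    have h4 : 0 ≤ ∫ t in Ioi 0, t ^ (s.re - 1) * (lg i + t)⁻¹ :=
      setIntegral_nonneg measurableSet_Ioi fun t (ht : 0 < t) => by
        have := lg_pos i
        positivity
    have h5 : ∫ t in Ioi 0, ‖F i t‖ = ‖α i‖ * ∫ t in Ioi 0, t ^ (s.re - 1) * (lg i + t)⁻¹ := by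
      rw [← integral_const_mul]
      refine setIntegral_congr_fun measurableSet_Ioi fun t (ht : 0 < t) => ?_
      simp only [hF]
      rw [norm_mul, norm_smul, Complex.norm_cpow_eq_rpow_re_of_pos ht, norm_inv_lg_add ht.le,
        Complex.sub_re, Complex.one_re]
    have h6 := congrArg norm (h3.symm.trans h2)
    rw [Complex.norm_real, Real.norm_of_nonneg h4, norm_mul, norm_lg_cpow, Complex.ofReal_re] at h6
    rw [h5, h6, mul_assoc]
  have hsum : Summable fun i => ∫ t in Ioi 0, ‖F i t‖ := by
    simp_rw [hnorm]
    exact (summable_norm_mul_lg_rpow hα h0.le h1).mul_right _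
  have h := hasSum_integral_of_summable_integral_norm hint hsum
  simp_rw [hval] at h
  rw [lgSeries, ← tsum_mul_right, h.tsum_eq, mellin]
  refine setIntegral_congr_fun measurableSet_Ioi fun t ht => ?_
  simp only [hF, cauchySum, smul_eq_mul]
  rw [← tsum_mul_left]
  exact tsum_congr fun i => by ring

end

/-! ### Sampling at the points log n against integration -/

/-- The difference between the sample `u(log n) (log n)^(s - 1) / n` and the integral of
`u(y) y^(s - 1)` over `[log n, log (n + 1)]`, where `n = i + 2`. -/
def sampleErr (u : ℝ → ℂ) (i : ℕ) (s : ℂ) : ℂ :=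
  u (lg i) * (lg i : ℂ) ^ (s - 1) / (i + 2) - ∫ y in lg i..lg (i + 1), u y * (y : ℂ) ^ (s - 1)

lemma norm_ofReal_cpow_le {y : ℝ} (hy : 1 / 2 ≤ y) {w : ℂ} (h1 : -1 ≤ w.re) (h2 : w.re ≤ 1) :
    ‖(y : ℂ) ^ w‖ ≤ 4 * y := by
  have hy0 : 0 < y := by linarith
  rw [Complex.norm_cpow_eq_rpow_re_of_pos hy0]
  rcases le_total 1 y with h | h
  · calc y ^ w.re ≤ y ^ (1 : ℝ) := Real.rpow_le_rpow_of_exponent_le h h2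
      _ ≤ 4 * y := by rw [Real.rpow_one]; linarith
  · calc y ^ w.re ≤ y ^ (-1 : ℝ) := Real.rpow_le_rpow_of_exponent_ge hy0 h h1
      _ ≤ 4 * y := by
        rw [Real.rpow_neg_one, inv_le_iff_one_le_mul₀ hy0]
        nlinarith

lemma norm_ofReal_cpow_sub_le {a b : ℝ} (ha : 1 / 2 ≤ a) {w : ℂ} (h1 : -1 ≤ w.re)
    (h2 : w.re ≤ 1) {x y : ℝ} (hx : x ∈ Icc a b) (hy : y ∈ Icc a b) :
    ‖(y : ℂ) ^ w - (x : ℂ) ^ w‖ ≤ 4 * ‖w‖ * |y - x| := by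
  rcases eq_or_ne w 0 with rfl | hw
  · simp
  have := (convex_Icc a b).norm_image_sub_le_of_norm_hasDerivWithin_le
    (f := fun t : ℝ => (t : ℂ) ^ w) (f' := fun t : ℝ => w * (t : ℂ) ^ (w - 1)) (C := 4 * ‖w‖)
    (fun t ht => (hasDerivAt_ofReal_cpow_const (by have := ht.1; intro h; linarith)
      hw).hasDerivWithinAt) (fun t ht => ?_) hx hy
  · rwa [Real.norm_eq_abs] at this
  · have ht0 : 0 < t := by linarith [ht.1]
    have htc : (t : ℂ) ≠ 0 := by exact_mod_cast ht0.ne'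
    rw [norm_mul, Complex.cpow_sub _ _ htc, Complex.cpow_one, norm_div, Complex.norm_real,
      Real.norm_of_nonneg ht0.le, mul_comm]
    gcongr
    rw [div_le_iff₀ ht0]
    exact norm_ofReal_cpow_le (ha.trans ht.1) h1 h2

section

variable {u : ℝ → ℂ} {K : ℝ}

/-- The interval from log n to log(n + 1) has length 1/n + O(1/n²), and over it a bounded Lipschitz
u times y^(s - 1) varies by O(log n / n). So the error is O(log n / n²) on the whole strip 0 ≤ Re s
≤ 2, with linear dependence on ‖s - 1‖; this is the source of the continuation beyond Re s = 1/2. -/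
lemma norm_sampleErr_le (hK : 0 ≤ K) (hb : ∀ x, lg 0 ≤ x → ‖u x‖ ≤ K)
    (hL : ∀ x y, lg 0 ≤ x → lg 0 ≤ y → ‖u x - u y‖ ≤ K * |x - y|) {s : ℂ} (h0 : 0 ≤ s.re)
    (h2 : s.re ≤ 2) (i : ℕ) :
    ‖sampleErr u i s‖ ≤ 8 * K * (1 + ‖s - 1‖) * (lg i / (i + 2 : ℝ) ^ 2) := by
  set w := s - 1 with hw
  have hw1 : -1 ≤ w.re := by simp [hw, h0]
  have hw2 : w.re ≤ 1 := by simp [hw]; linarith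
  set d := lg i with hd
  set d' := lg (i + 1) with hd'
  have hdd : d ≤ d' := (lg_lt_succ i).le
  have hlen : d' - d ≤ 1 / (i + 2 : ℝ) := lg_succ_sub_le i
  have hlen' : 1 / (i + 3 : ℝ) ≤ d' - d := le_lg_succ_sub i
  have hhalf : 1 / 2 ≤ d := half_le_lg i
  have h0d : lg 0 ≤ d := strictMono_lg.monotone (Nat.zero_le i)
  have hi : (0 : ℝ) ≤ i := Nat.cast_nonneg i
  have huc : ContinuousOn u (Icc d d') :=
    (LipschitzOnWith.of_dist_le_mul (K := K.toNNReal) fun x hx y hy => by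
      rw [Real.coe_toNNReal _ hK, dist_eq_norm, Real.dist_eq]
      exact hL x y (h0d.trans hx.1) (h0d.trans hy.1)).continuousOn
  have hint : IntervalIntegrable (fun y : ℝ => u y * (y : ℂ) ^ w) volume d d' := by
    refine ContinuousOn.intervalIntegrable ?_
    rw [uIcc_of_le hdd]
    refine huc.mul fun y hy => ContinuousAt.continuousWithinAt ?_
    exact Complex.continuousAt_ofReal_cpow_const _ _ (Or.inr (by have := hy.1; intro h; linarith))
  -- The first part is the mismatch between the weight 1/n and the length of the interval, the
  -- second the variation of the integrand on it.
  have hsplit : sampleErr u i s = u d * (d : ℂ) ^ w * ((1 / (i + 2 : ℝ) - (d' - d) : ℝ) : ℂ) +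
      ∫ y in d..d', (u d * (d : ℂ) ^ w - u y * (y : ℂ) ^ w) := by
    rw [intervalIntegral.integral_sub (by simp) hint, intervalIntegral.integral_const, sampleErr]
    simp only [Complex.real_smul]
    push_cast
    ring
  have hcp := norm_ofReal_cpow_le hhalf hw1 hw2
  have A : ‖u d * (d : ℂ) ^ w * ((1 / (i + 2 : ℝ) - (d' - d) : ℝ) : ℂ)‖ ≤
      K * (4 * d) * (1 / (i + 2 : ℝ) ^ 2) := by
    rw [norm_mul, norm_mul, Complex.norm_real, Real.norm_of_nonneg (by linarith)]
    have : 1 / (i + 2 : ℝ) - (d' - d) ≤ 1 / (i + 2 : ℝ) ^ 2 := by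
      have : 1 / (i + 2 : ℝ) - 1 / (i + 3 : ℝ) ≤ 1 / (i + 2 : ℝ) ^ 2 := by
        rw [div_sub_div _ _ (by positivity) (by positivity),
          div_le_div_iff₀ (by positivity) (by positivity)]
        nlinarith
      linarith
    have hub := hb d h0d
    have h5 : 0 ≤ 1 / (i + 2 : ℝ) - (d' - d) := by linarith
    have h6 : 0 ≤ K * (4 * d) := by positivity
    gcongr
  have B : ‖∫ y in d..d', (u d * (d : ℂ) ^ w - u y * (y : ℂ) ^ w)‖ ≤
      (K * (4 * d + 4 * ‖w‖) * (1 / (i + 2 : ℝ))) * (1 / (i + 2 : ℝ)) := by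
    refine (intervalIntegral.norm_integral_le_of_norm_le_const (C :=
      K * (4 * d + 4 * ‖w‖) * (1 / (i + 2 : ℝ))) fun y hy => ?_).trans ?_
    · rw [uIoc_of_le hdd] at hy
      have hyI : y ∈ Icc d d' := ⟨hy.1.le, hy.2⟩
      have hyl : |d - y| ≤ 1 / (i + 2 : ℝ) := by
        rw [abs_sub_comm, abs_of_nonneg (by linarith [hy.1])]
        linarith [hy.2]
      have e : u d * (d : ℂ) ^ w - u y * (y : ℂ) ^ w =
          (u d - u y) * (d : ℂ) ^ w + u y * ((d : ℂ) ^ w - (y : ℂ) ^ w) := by ring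
      rw [e]
      have h3 := hL d y h0d (h0d.trans hyI.1)
      have h4 := norm_ofReal_cpow_sub_le hhalf hw1 hw2 hyI (left_mem_Icc.2 hdd)
      have h5 := hb y (h0d.trans hyI.1)
      calc ‖(u d - u y) * (d : ℂ) ^ w + u y * ((d : ℂ) ^ w - (y : ℂ) ^ w)‖
          ≤ ‖u d - u y‖ * ‖(d : ℂ) ^ w‖ + ‖u y‖ * ‖(d : ℂ) ^ w - (y : ℂ) ^ w‖ := by
            refine (norm_add_le _ _).trans ?_
            rw [norm_mul, norm_mul]
        _ ≤ (K * |d - y|) * (4 * d) + K * (4 * ‖w‖ * |d - y|) := by gcongr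
        _ = K * (4 * d + 4 * ‖w‖) * |d - y| := by ring
        _ ≤ _ := by gcongr
    · rw [abs_of_nonneg (by linarith)]
      gcongr
  rw [hsplit]
  refine (norm_add_le _ _).trans ((add_le_add A B).trans ?_)
  have h7 : 1 ≤ 2 * d := by linarith
  have h8 : K * (4 * d) + K * (4 * d + 4 * ‖w‖) ≤ 8 * K * (1 + ‖w‖) * d := by
    nlinarith [mul_le_mul_of_nonneg_left h7 (mul_nonneg hK (norm_nonneg w))]
  calc K * (4 * d) * (1 / (i + 2 : ℝ) ^ 2) +
        (K * (4 * d + 4 * ‖w‖) * (1 / (i + 2 : ℝ))) * (1 / (i + 2 : ℝ))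
      = (K * (4 * d) + K * (4 * d + 4 * ‖w‖)) * (1 / (i + 2 : ℝ) ^ 2) := by
        field_simp
    _ ≤ (8 * K * (1 + ‖w‖) * d) * (1 / (i + 2 : ℝ) ^ 2) := by gcongr
    _ = _ := by ring

lemma summable_lg_div_sq : Summable fun i : ℕ => lg i / (i + 2 : ℝ) ^ 2 := by
  have h1 : Summable fun i : ℕ => 2 * ((i + 2 : ℕ) : ℝ) ^ (-(3 / 2) : ℝ) :=
    (((summable_nat_add_iff 2).2 (Real.summable_nat_rpow.2 (by norm_num : (-(3 / 2) : ℝ) < -1)))).mul_left 2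
  refine Summable.of_nonneg_of_le (fun i => by have := lg_pos i; positivity) (fun i => ?_) h1
  have hi : (0 : ℝ) < (i : ℝ) + 2 := by positivity
  have h := Real.log_le_rpow_div hi.le (ε := 1 / 2) (by norm_num)
  have e : ((i + 2 : ℕ) : ℝ) ^ (-(3 / 2) : ℝ) = ((i : ℝ) + 2) ^ (1 / 2 : ℝ) / ((i : ℝ) + 2) ^ 2 := by
    push_cast
    rw [← Real.rpow_natCast, ← Real.rpow_sub hi]
    norm_num
  rw [e]
  unfold lg
  rw [← mul_div_assoc]
  gcongr
  linarith

lemma summable_sampleErr (hK : 0 ≤ K) (hb : ∀ x, lg 0 ≤ x → ‖u x‖ ≤ K)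
    (hL : ∀ x y, lg 0 ≤ x → lg 0 ≤ y → ‖u x - u y‖ ≤ K * |x - y|) {s : ℂ} (h0 : 0 ≤ s.re)
    (h2 : s.re ≤ 2) : Summable fun i => sampleErr u i s :=
  Summable.of_norm_bounded (summable_lg_div_sq.mul_left _) (norm_sampleErr_le hK hb hL h0 h2)

lemma norm_tsum_sampleErr_le (hK : 0 ≤ K) (hb : ∀ x, lg 0 ≤ x → ‖u x‖ ≤ K)
    (hL : ∀ x y, lg 0 ≤ x → lg 0 ≤ y → ‖u x - u y‖ ≤ K * |x - y|) {s : ℂ} (h0 : 0 ≤ s.re)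
    (h2 : s.re ≤ 2) :
    ‖∑' i, sampleErr u i s‖ ≤
      8 * K * (1 + ‖s - 1‖) * ∑' i : ℕ, lg i / (i + 2 : ℝ) ^ 2 :=
  tsum_of_norm_bounded (summable_lg_div_sq.hasSum.mul_left _) (norm_sampleErr_le hK hb hL h0 h2)

lemma differentiable_integral_cpow {a b : ℝ} (ha : 0 < a) (hab : a ≤ b)
    (hu : ContinuousOn u (Icc a b)) :
    Differentiable ℂ fun s : ℂ => ∫ y in a..b, u y * (y : ℂ) ^ (s - 1) := by
  -- Cutting u off to a compact subinterval of (0, ∞) makes the integral a Mellin transform without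
  -- convergence restrictions, hence entire.
  have e : (fun s : ℂ => ∫ y in a..b, u y * (y : ℂ) ^ (s - 1)) =
      mellin ((Ioc a b).indicator u) := by
    funext s
    rw [mellin, intervalIntegral.integral_of_le hab]
    have h1 : ∀ t : ℝ, (t : ℂ) ^ (s - 1) • (Ioc a b).indicator u t =
        (Ioc a b).indicator (fun y : ℝ => u y * (y : ℂ) ^ (s - 1)) t := fun t => by
      by_cases ht : t ∈ Ioc a b
      · simp [ht, mul_comm]
      · simp [ht]
    simp_rw [h1]
    rw [setIntegral_indicator measurableSet_Ioc,
      inter_eq_right.2 (Ioc_subset_Ioi_self.trans (Ioi_subset_Ioi ha.le))]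
  rw [e]
  intro s
  refine mellin_differentiableAt_of_isBigO_rpow (a := s.re + 1) (b := s.re - 1) ?_ ?_
    (by linarith) ?_ (by linarith)
  · have : IntegrableOn u (Ioc a b) := (hu.integrableOn_Icc).mono_set Ioc_subset_Icc_self
    exact ((integrable_indicator_iff measurableSet_Ioc).2 this).locallyIntegrable.locallyIntegrableOn _
  · refine Asymptotics.IsBigO.of_bound 0 ?_
    filter_upwards [eventually_gt_atTop b] with t ht
    rw [indicator_of_notMem fun h => absurd h.2 (not_le.2 ht)]
    simp
  · refine Asymptotics.IsBigO.of_bound 0 ?_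
    filter_upwards [mem_nhdsWithin_of_mem_nhds (Iio_mem_nhds ha)] with t ht
    rw [indicator_of_notMem fun h => absurd h.1 (not_lt.2 (le_of_lt ht))]
    simp

lemma differentiable_sampleErr (hK : 0 ≤ K)
    (hL : ∀ x y, lg 0 ≤ x → lg 0 ≤ y → ‖u x - u y‖ ≤ K * |x - y|) (i : ℕ) :
    Differentiable ℂ (sampleErr u i) := by
  have hd : (lg i : ℂ) ≠ 0 := by exact_mod_cast (lg_pos i).ne'
  have h0d : lg 0 ≤ lg i := strictMono_lg.monotone (Nat.zero_le i)
  have huc : ContinuousOn u (Icc (lg i) (lg (i + 1))) :=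
    (LipschitzOnWith.of_dist_le_mul (K := K.toNNReal) fun x hx y hy => by
      rw [Real.coe_toNNReal _ hK, dist_eq_norm, Real.dist_eq]
      exact hL x y (h0d.trans hx.1) (h0d.trans hy.1)).continuousOn
  refine Differentiable.sub ?_ (differentiable_integral_cpow (lg_pos i) (lg_lt_succ i).le huc)
  intro s
  exact (((differentiableAt_id.sub_const 1).const_cpow (Or.inl hd)).const_mul _).div_const _

lemma differentiableOn_tsum_sampleErr (hK : 0 ≤ K) (hb : ∀ x, lg 0 ≤ x → ‖u x‖ ≤ K)
    (hL : ∀ x y, lg 0 ≤ x → lg 0 ≤ y → ‖u x - u y‖ ≤ K * |x - y|) :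
    DifferentiableOn ℂ (fun s => ∑' i, sampleErr u i s) {s | 0 < s.re ∧ s.re < 2} := by
  intro s hs
  -- The bound on the terms grows with ‖s - 1‖, so the Weierstrass test is applied on a bounded
  -- piece of the strip around the given point.
  have hopen : IsOpen ({s : ℂ | 0 < s.re ∧ s.re < 2} ∩ Metric.ball 1 (‖s - 1‖ + 1)) :=
    ((isOpen_lt continuous_const Complex.continuous_re).inter
      (isOpen_lt Complex.continuous_re continuous_const)).inter Metric.isOpen_ball
  have h := Complex.differentiableOn_tsum_of_summable_norm
    (summable_lg_div_sq.mul_left (8 * K * (1 + (‖s - 1‖ + 1))))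
    (fun i => (differentiable_sampleErr hK hL i).differentiableOn) hopen (fun i w hw => by
      refine (norm_sampleErr_le hK hb hL hw.1.1.le hw.1.2.le i).trans ?_
      have h1 : ‖w - 1‖ ≤ ‖s - 1‖ + 1 := by
        have := hw.2
        rw [Metric.mem_ball, dist_eq_norm] at this
        exact this.le
      have := lg_pos i
      gcongr)
  exact ((h s ⟨hs, by rw [Metric.mem_ball, dist_eq_norm]; linarith⟩).differentiableAt
    (hopen.mem_nhds ⟨hs, by rw [Metric.mem_ball, dist_eq_norm]; linarith⟩)).differentiableWithinAt

/-- The integrals over consecutive intervals add up to the integral from lg 0 to lg N, and lg N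
tends to infinity. -/
lemma tsum_sampleErr {s : ℂ} (hs : Summable fun i => sampleErr u i s)
    (hu : Summable fun i : ℕ => u (lg i) * (lg i : ℂ) ^ (s - 1) / (i + 2))
    (hint : IntegrableOn (fun y : ℝ => u y * (y : ℂ) ^ (s - 1)) (Ioi (lg 0))) :
    ∑' i, sampleErr u i s = ∑' i : ℕ, u (lg i) * (lg i : ℂ) ^ (s - 1) / (i + 2) -
      ∫ y in Ioi (lg 0), u y * (y : ℂ) ^ (s - 1) := by
  have h1 := (hu.hasSum.sub hs.hasSum).tendsto_sum_nat
  have h2 : ∀ N, ∑ i ∈ Finset.range N, (u (lg i) * (lg i : ℂ) ^ (s - 1) / (i + 2) - sampleErr u i s)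
      = ∫ y in lg 0..lg N, u y * (y : ℂ) ^ (s - 1) := fun N => by
    rw [← intervalIntegral.sum_integral_adjacent_intervals]
    · exact Finset.sum_congr rfl fun i _ => by rw [sampleErr]; ring
    · intro k _
      rw [intervalIntegrable_iff_integrableOn_Ioc_of_le (lg_lt_succ k).le]
      exact hint.mono_set (Ioc_subset_Ioi_self.trans
        (Ioi_subset_Ioi (strictMono_lg.monotone (Nat.zero_le k))))
  simp_rw [h2] at h1
  have h3 := tendsto_nhds_unique h1 (intervalIntegral_tendsto_integral_Ioi (lg 0) hint tendsto_lg)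
  rw [← h3]
  ring

end

/-! ### The functional equation -/

section

variable {α : ℕ → ℂ}

/-- The constant is larger than needed so that it also serves as the Lipschitz constant in
`norm_cauchySum_sub_div_sub_le`; the sampling estimates take a single K for both. -/
lemma norm_cauchySum_sub_div_le (hα : Summable fun i => ‖α i‖ / lg i) (c : ℂ) {x : ℝ}
    (hx : lg 0 ≤ x) :
    ‖cauchySum α x - c / (x : ℂ)‖ ≤ 2 * (∑' i, ‖α i‖ / lg i) + 4 * ‖c‖ := by
  have hl := half_le_lg 0
  have hx0 : 0 < x := by linarith
  have h1 := norm_cauchySum_le hα hx0.le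
  have h2 : ‖c / (x : ℂ)‖ ≤ 2 * ‖c‖ := by
    rw [norm_div, Complex.norm_real, Real.norm_of_nonneg hx0.le, div_le_iff₀ hx0]
    nlinarith [norm_nonneg c]
  have h3 : 0 ≤ ∑' i, ‖α i‖ / lg i := (norm_nonneg _).trans h1
  linarith [norm_sub_le (cauchySum α x) (c / (x : ℂ)), norm_nonneg c]

lemma norm_cauchySum_sub_div_sub_le (hα : Summable fun i => ‖α i‖ / lg i) (c : ℂ) {x y : ℝ}
    (hx : lg 0 ≤ x) (hy : lg 0 ≤ y) :
    ‖(cauchySum α x - c / (x : ℂ)) - (cauchySum α y - c / (y : ℂ))‖ ≤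
      (2 * (∑' i, ‖α i‖ / lg i) + 4 * ‖c‖) * |x - y| := by
  have hl := half_le_lg 0
  have hx0 : 0 < x := by linarith
  have hy0 : 0 < y := by linarith
  have h1 := norm_cauchySum_sub_le hα hx0.le hy0.le
  have h2 : ‖c / (x : ℂ) - c / (y : ℂ)‖ ≤ 4 * ‖c‖ * |x - y| := by
    have e : c / (x : ℂ) - c / (y : ℂ) = c * (((y - x) / (x * y) : ℝ) : ℂ) := by
      have hxc : (x : ℂ) ≠ 0 := by exact_mod_cast hx0.ne'
      have hyc : (y : ℂ) ≠ 0 := by exact_mod_cast hy0.ne'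
      push_cast
      field_simp
    rw [e, norm_mul, Complex.norm_real, norm_div, Real.norm_eq_abs, abs_sub_comm,
      Real.norm_of_nonneg (by positivity)]
    have h3 : |x - y| / (x * y) ≤ 4 * |x - y| := by
      rw [div_le_iff₀ (by positivity)]
      have : 1 / 4 ≤ x * y := by nlinarith
      nlinarith [abs_nonneg (x - y)]
    calc ‖c‖ * (|x - y| / (x * y)) ≤ ‖c‖ * (4 * |x - y|) := by gcongr
      _ = _ := by ring
  have e : (cauchySum α x - c / (x : ℂ)) - (cauchySum α y - c / (y : ℂ)) =
      (cauchySum α x - cauchySum α y) - (c / (x : ℂ) - c / (y : ℂ)) := by ring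
  rw [e]
  calc _ ≤ _ := norm_sub_le _ _
    _ ≤ 2 * (∑' i, ‖α i‖ / lg i) * |x - y| + 4 * ‖c‖ * |x - y| := add_le_add h1 h2
    _ = _ := by ring

lemma lg_zero_le_one : lg 0 ≤ 1 := by
  simp only [lg, Nat.cast_zero, zero_add]
  linarith [Real.log_two_lt_d9]

lemma mellin_indicator_cauchySum (s : ℂ) : mellin ((Ioc 0 (lg 0)).indicator (cauchySum α)) s =
    ∫ y in Ioc 0 (lg 0), cauchySum α y * (y : ℂ) ^ (s - 1) := by
  have h1 : ∀ t : ℝ, (t : ℂ) ^ (s - 1) • (Ioc 0 (lg 0)).indicator (cauchySum α) t =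
      (Ioc 0 (lg 0)).indicator (fun y : ℝ => cauchySum α y * (y : ℂ) ^ (s - 1)) t := fun t => by
    by_cases ht : t ∈ Ioc 0 (lg 0)
    · simp only [indicator_of_mem ht, smul_eq_mul, mul_comm]
    · simp only [indicator_of_notMem ht, smul_zero]
  simp_rw [mellin, h1]
  rw [setIntegral_indicator measurableSet_Ioc, inter_eq_right.2 Ioc_subset_Ioi_self]

lemma differentiableAt_mellin_indicator (hα : Summable fun i => ‖α i‖ / lg i) {s : ℂ}
    (hs : 0 < s.re) :
    DifferentiableAt ℂ (mellin ((Ioc 0 (lg 0)).indicator (cauchySum α))) s := by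
  refine mellin_differentiableAt_of_isBigO_rpow (a := s.re + 1) (b := 0) ?_ ?_ (by linarith) ?_ hs
  · have : IntegrableOn (cauchySum α) (Ioc 0 (lg 0)) :=
      (((continuousOn_cauchySum hα).mono Icc_subset_Ici_self).integrableOn_Icc).mono_set
        Ioc_subset_Icc_self
    exact ((integrable_indicator_iff measurableSet_Ioc).2 this).locallyIntegrable.locallyIntegrableOn _
  · refine Asymptotics.IsBigO.of_bound 0 ?_
    filter_upwards [eventually_gt_atTop (lg 0)] with t ht
    rw [indicator_of_notMem fun h => absurd h.2 (not_le.2 ht)]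
    simp
  · refine Asymptotics.IsBigO.of_bound (∑' i, ‖α i‖ / lg i) ?_
    filter_upwards [self_mem_nhdsWithin] with t ht
    rw [neg_zero, Real.rpow_zero, norm_one, mul_one]
    exact (norm_indicator_le_norm_self _ _).trans (norm_cauchySum_le hα (le_of_lt ht))

lemma norm_mellin_indicator_le (hα : Summable fun i => ‖α i‖ / lg i) {s : ℂ} (hs : 1 / 4 ≤ s.re) :
    ‖mellin ((Ioc 0 (lg 0)).indicator (cauchySum α)) s‖ ≤ 4 * ∑' i, ‖α i‖ / lg i := by
  set K := ∑' i, ‖α i‖ / lg i with hKdef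
  have hK : 0 ≤ K := tsum_nonneg fun i => div_nonneg (norm_nonneg _) (lg_pos i).le
  have hl := lg_pos 0
  rw [mellin_indicator_cauchySum, ← intervalIntegral.integral_of_le hl.le]
  have h1 : ‖∫ y in 0..lg 0, cauchySum α y * (y : ℂ) ^ (s - 1)‖ ≤
      ∫ y in 0..lg 0, K * y ^ (s.re - 1) := by
    refine intervalIntegral.norm_integral_le_of_norm_le hl.le
      (Eventually.of_forall fun y hy => ?_)
      ((intervalIntegral.intervalIntegrable_rpow' (by linarith)).const_mul _)
    rw [norm_mul, Complex.norm_cpow_eq_rpow_re_of_pos hy.1, Complex.sub_re, Complex.one_re]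
    have := norm_cauchySum_le hα hy.1.le
    have := Real.rpow_nonneg hy.1.le (s.re - 1)
    gcongr
  refine h1.trans ?_
  rw [intervalIntegral.integral_const_mul, integral_rpow (Or.inl (by linarith)), sub_add_cancel,
    Real.zero_rpow (by linarith), sub_zero]
  have h2 : lg 0 ^ s.re ≤ 1 := Real.rpow_le_one hl.le lg_zero_le_one (by linarith)
  have h3 : lg 0 ^ s.re / s.re ≤ 4 := by
    rw [div_le_iff₀ (by linarith)]
    linarith
  nlinarith

/-- The functional equation of the series `∑ α_i (lg i)^(s - 1)`. -/
lemma exists_lgSeries_equation (hα : Summable fun i : ℕ => (i + 2 : ℝ) * ‖α i‖ ^ 2) {lam : ℝ}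
    {c : ℂ} (heq : ∀ i : ℕ, lam * ((i + 2) * α i) = cauchySum α (lg i) - c / (lg i : ℂ)) :
    ∃ (G : ℂ → ℂ) (C : ℝ), 0 ≤ C ∧ DifferentiableOn ℂ G {s | 0 < s.re ∧ s.re < 2} ∧
      (∀ s : ℂ, 1 / 4 ≤ s.re → s.re ≤ 5 / 4 → ‖G s‖ ≤ C * (1 + ‖s - 1‖)) ∧
      ∀ s : ℂ, 0 < s.re → s.re < 1 / 2 → lam * lgSeries α s = G s +
        lgSeries α s * (Real.pi / Complex.sin (Real.pi * s)) -
          c * ((lg 0 : ℂ) ^ (s - 1) / (1 - s)) := by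
  have hK := summable_norm_div_lg hα
  set u : ℝ → ℂ := fun y => cauchySum α y - c / (y : ℂ) with hu
  set K := 2 * (∑' i, ‖α i‖ / lg i) + 4 * ‖c‖ with hKdef
  have hK0 : 0 ≤ ∑' i, ‖α i‖ / lg i := tsum_nonneg fun i => div_nonneg (norm_nonneg _) (lg_pos i).le
  have hKn : 0 ≤ K := by positivity
  have hb : ∀ x, lg 0 ≤ x → ‖u x‖ ≤ K := fun x hx => norm_cauchySum_sub_div_le hK c hx
  have hL : ∀ x y, lg 0 ≤ x → lg 0 ≤ y → ‖u x - u y‖ ≤ K * |x - y| :=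
    fun x y hx hy => norm_cauchySum_sub_div_sub_le hK c hx hy
  set S := ∑' i : ℕ, lg i / (i + 2 : ℝ) ^ 2 with hS
  have hS0 : 0 ≤ S := tsum_nonneg fun i => div_nonneg (lg_pos i).le (by positivity)
  -- G consists of what is analytic in the whole strip: the total sampling error, and the part of
  -- the Mellin integral over (0, log 2], which lies to the left of all sample points.
  refine ⟨fun s => ∑' i, sampleErr u i s - mellin ((Ioc 0 (lg 0)).indicator (cauchySum α)) s,
    8 * K * S + 4 * ∑' i, ‖α i‖ / lg i, by positivity, ?_, ?_, ?_⟩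
  · exact (differentiableOn_tsum_sampleErr hKn hb hL).sub fun s hs =>
      (differentiableAt_mellin_indicator hK hs.1).differentiableWithinAt
  · intro s h1 h2
    refine (norm_sub_le _ _).trans ((add_le_add
      (norm_tsum_sampleErr_le hKn hb hL (by linarith) (by linarith))
      (norm_mellin_indicator_le hK h1)).trans ?_)
    have := norm_nonneg (s - 1)
    nlinarith [mul_nonneg hK0 this]
  · intro s h0 h1
    have hlg := lg_pos 0
    have hφ := mellinConvergent_cauchySum hα h0 h1
    have hφ' : IntegrableOn (fun y : ℝ => cauchySum α y * (y : ℂ) ^ (s - 1)) (Ioi 0) := by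
      simpa only [MellinConvergent, smul_eq_mul, mul_comm] using hφ
    have hp : IntegrableOn (fun y : ℝ => (y : ℂ) ^ (s - 2)) (Ioi (lg 0)) :=
      integrableOn_Ioi_cpow_of_lt (by simp; linarith) hlg
    have hue : ∀ y ∈ Ioi (lg 0), u y * (y : ℂ) ^ (s - 1) =
        cauchySum α y * (y : ℂ) ^ (s - 1) - c * (y : ℂ) ^ (s - 2) := fun y hy => by
      have hyc : (y : ℂ) ≠ 0 := by exact_mod_cast (hlg.trans hy).ne'
      simp only [hu]
      rw [show s - 1 = s - 2 + 1 by ring, Complex.cpow_add _ _ hyc, Complex.cpow_one]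
      field_simp
    have hI1 := hφ'.mono_set (Ioi_subset_Ioi hlg.le)
    have hint : IntegrableOn (fun y : ℝ => u y * (y : ℂ) ^ (s - 1)) (Ioi (lg 0)) :=
      (hI1.sub (hp.const_mul c)).congr_fun (fun y hy => (hue y hy).symm) measurableSet_Ioi
    -- The equation is used here: the samples are λ times the terms of `lgSeries`.
    have hterm : ∀ i : ℕ, u (lg i) * (lg i : ℂ) ^ (s - 1) / (i + 2) =
        lam * (α i * (lg i : ℂ) ^ (s - 1)) := fun i => by
      have : (i : ℂ) + 2 ≠ 0 := by exact_mod_cast (by positivity : (i : ℝ) + 2 ≠ 0)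
      simp only [hu]
      rw [← heq i]
      field_simp
    have hsB : Summable fun i => α i * (lg i : ℂ) ^ (s - 1) := by
      refine Summable.of_norm ?_
      simp_rw [norm_mul, norm_lg_cpow]
      exact summable_norm_mul_lg_rpow hα h0.le h1
    have hsum := tsum_sampleErr (summable_sampleErr hKn hb hL h0.le (by linarith))
      ((hsB.mul_left (lam : ℂ)).congr fun i => (hterm i).symm) hint
    simp_rw [hterm] at hsum
    rw [tsum_mul_left, setIntegral_congr_fun measurableSet_Ioi hue,
      integral_sub hI1 (hp.const_mul c), integral_const_mul,
      integral_Ioi_cpow_of_lt (by simp; linarith) hlg] at hsum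
    have hM : mellin (cauchySum α) s = mellin ((Ioc 0 (lg 0)).indicator (cauchySum α)) s +
        ∫ y in Ioi (lg 0), cauchySum α y * (y : ℂ) ^ (s - 1) := by
      rw [mellin_indicator_cauchySum, mellin]
      simp_rw [smul_eq_mul, mul_comm _ (cauchySum α _)]
      rw [← Ioc_union_Ioi_eq_Ioi hlg.le, setIntegral_union Ioc_disjoint_Ioi_same measurableSet_Ioi
        (hφ'.mono_set Ioc_subset_Ioi_self) hI1]
    rw [mellin_cauchySum hα h0 h1] at hM
    have hs1 : 1 - s ≠ 0 := fun h => by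
      have := congrArg Complex.re h
      simp at this
      linarith
    -- The integral of c y^(s - 2) over (log 2, ∞) supplies the only explicit pole, at s = 1.
    have e : -(lg 0 : ℂ) ^ (s - 2 + 1) / (s - 2 + 1) = (lg 0 : ℂ) ^ (s - 1) / (1 - s) := by
      rw [show s - 2 + 1 = s - 1 by ring, neg_div, ← div_neg, neg_sub]
    rw [e] at hsum
    change _ = (∑' i, sampleErr u i s - _) + _ - _
    rw [hM, hsum, lgSeries]
    ring

end

/-! ### Tools from complex analysis -/

/-- A quotient of analytic functions whose growth along one ray towards each zero of the
denominator is slower than that of a simple pole has an analytic extension. -/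
lemma exists_differentiableOn_quotient {U : Set ℂ} (hU : IsOpen U) {f g : ℂ → ℂ}
    (hf : DifferentiableOn ℂ f U) (hg : DifferentiableOn ℂ g U)
    (h : ∀ z ∈ U, g z = 0 → ∀ᶠ ε : ℝ in 𝓝[>] 0, g (z - ε) ≠ 0)
    (h' : ∀ z ∈ U, g z = 0 → Tendsto (fun ε : ℝ => (ε : ℂ) * (f (z - ε) / g (z - ε))) (𝓝[>] 0) (𝓝 0)) :
    ∃ A : ℂ → ℂ, DifferentiableOn ℂ A U ∧ ∀ z ∈ U, g z * A z = f z := by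
  have hfa : ∀ z ∈ U, AnalyticAt ℂ f z := fun z hz => hf.analyticAt (hU.mem_nhds hz)
  have hga : ∀ z ∈ U, AnalyticAt ℂ g z := fun z hz => hg.analyticAt (hU.mem_nhds hz)
  have hpath : ∀ z : ℂ, Tendsto (fun ε : ℝ => z - ε) (𝓝[>] 0) (𝓝[≠] z) := by
    intro z
    refine tendsto_nhdsWithin_iff.2 ⟨?_, ?_⟩
    · have : Continuous fun ε : ℝ => z - (ε : ℂ) := by fun_prop
      have h1 := this.tendsto 0
      simp only [Complex.ofReal_zero, sub_zero] at h1
      exact h1.mono_left nhdsWithin_le_nhds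
    · filter_upwards [self_mem_nhdsWithin] with ε hε
      have hε : 0 < ε := hε
      simp [hε.ne']
  have hne : ∀ z ∈ U, ∀ᶠ w in 𝓝[≠] z, g w ≠ 0 := by
    intro z hz
    -- If g vanished identically near z, it would vanish along the ray, contrary to `h`.
    rcases (hga z hz).eventually_eq_zero_or_eventually_ne_zero with h0 | h0
    · exfalso
      have h1 := h z hz h0.self_of_nhds
      have h2 := ((hpath z).mono_right nhdsWithin_le_nhds).eventually h0
      obtain ⟨ε, h3, h4⟩ := (h1.and h2).exists
      exact h3 h4
    · exact h0
  have hm : MeromorphicOn (f / g) U := fun z hz =>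
    (hfa z hz).meromorphicAt.div (hga z hz).meromorphicAt
  have hord : ∀ z ∈ U, 0 ≤ meromorphicOrderAt (f / g) z := by
    intro z hz
    by_cases hgz : g z = 0
    · by_contra! hneg
      -- A pole of f / g would leave q with order at most 0, so q would tend to infinity or to a
      -- nonzero limit at z; along the ray it tends to 0.
      set q : ℂ → ℂ := (fun w => w - z) * (f / g) with hq
      have hid : MeromorphicAt (fun w : ℂ => w - z) z := by fun_prop
      have hqm : MeromorphicAt q z := hid.mul (hm z hz)
      have hoq : meromorphicOrderAt q z ≤ 0 := by
        rw [hq, meromorphicOrderAt_mul hid (hm z hz), meromorphicOrderAt_id_sub_const]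
        obtain ⟨n, hn⟩ := WithTop.ne_top_iff_exists.1 hneg.ne_top
        rw [← hn] at hneg ⊢
        have h5 : n < 0 := by exact_mod_cast hneg
        have h6 : (1 : ℤ) + n ≤ 0 := by omega
        exact_mod_cast h6
      have hlim : Tendsto (fun ε : ℝ => q (z - ε)) (𝓝[>] 0) (𝓝 0) := by
        have := (h' z hz hgz).neg
        rw [neg_zero] at this
        refine this.congr fun ε => ?_
        simp [hq]
      rcases hoq.lt_or_eq with h7 | h7
      · have h8 := (tendsto_cobounded_of_meromorphicOrderAt_neg h7).comp (hpath z)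
        exact (hlim.not_tendsto (Metric.disjoint_nhds_cobounded 0)) h8
      · obtain ⟨c, hc, hc'⟩ := tendsto_ne_zero_of_meromorphicOrderAt_eq_zero hqm h7
        exact hc (tendsto_nhds_unique (hc'.comp (hpath z)) hlim)
    · exact ((hfa z hz).div (hga z hz) hgz).meromorphicOrderAt_nonneg
  have hA : ∀ z ∈ U, AnalyticAt ℂ (toMeromorphicNFOn (f / g) U) z := fun z hz => by
    rw [← (meromorphicNFOn_toMeromorphicNFOn (f / g) U hz).meromorphicOrderAt_nonneg_iff_analyticAt,
      meromorphicOrderAt_toMeromorphicNFOn hm hz]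
    exact hord z hz
  -- The meromorphic normal form fills in the removable singularities.
  refine ⟨toMeromorphicNFOn (f / g) U, fun z hz =>
    (hA z hz).differentiableAt.differentiableWithinAt, fun z hz => ?_⟩
  have h1 : Tendsto (fun w => g w * toMeromorphicNFOn (f / g) U w) (𝓝[≠] z)
      (𝓝 (g z * toMeromorphicNFOn (f / g) U z)) :=
    (((hga z hz).continuousAt.mul (hA z hz).continuousAt).tendsto).mono_left nhdsWithin_le_nhds
  have h2 : Tendsto f (𝓝[≠] z) (𝓝 (f z)) :=
    ((hfa z hz).continuousAt.tendsto).mono_left nhdsWithin_le_nhds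
  refine tendsto_nhds_unique h1 (h2.congr' ?_)
  filter_upwards [hne z hz, hm.toMeromorphicNFOn_eq_self_on_nhdsNE hz] with w hw hw'
  rw [hw', Pi.div_apply, mul_div_cancel₀ _ hw]

/-- Shifting a vertical line of integration. -/
lemma integral_vertical_eq {f : ℂ → ℂ} {a b C : ℝ} (hab : a ≤ b)
    (hf : DifferentiableOn ℂ f (Complex.re ⁻¹' Icc a b))
    (hC : ∀ s : ℂ, a ≤ s.re → s.re ≤ b → ‖f s‖ ≤ C * (1 + s.im ^ 2)⁻¹) :
    ∫ t : ℝ, f (a + t * Complex.I) = ∫ t : ℝ, f (b + t * Complex.I) := by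
  have hint : ∀ x, a ≤ x → x ≤ b → Integrable fun t : ℝ => f (x + t * Complex.I) := by
    intro x hax hxb
    refine (integrable_inv_one_add_sq.const_mul C).mono' ?_ (Eventually.of_forall fun t => ?_)
    · refine Continuous.aestronglyMeasurable ?_
      refine hf.continuousOn.comp_continuous (by fun_prop) fun t => ?_
      simpa using ⟨hax, hxb⟩
    · simpa using hC (x + t * Complex.I) (by simpa using hax) (by simpa using hxb)
  have hrect : ∀ T : ℝ, Complex.I * ((∫ t in -T..T, f (b + t * Complex.I)) -
      ∫ t in -T..T, f (a + t * Complex.I)) =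
      (∫ x in a..b, f (x + T * Complex.I)) - ∫ x in a..b, f (x + (-T : ℝ) * Complex.I) := by
    intro T
    have h := Complex.integral_boundary_rect_eq_zero_of_differentiableOn f
      ((a : ℂ) + (-T : ℝ) * Complex.I) ((b : ℂ) + T * Complex.I) (hf.mono fun s hs => by
        have := hs.1
        simp [uIcc_of_le hab] at this
        exact this)
    simp only [Complex.add_re, Complex.ofReal_re, Complex.mul_re, Complex.I_re, mul_zero,
      Complex.ofReal_im, Complex.I_im, mul_one, sub_self, add_zero, Complex.add_im,
      Complex.mul_im, zero_add, smul_eq_mul] at h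
    linear_combination h
  -- Both horizontal sides tend to 0; ι stands for T or -T, and only its square enters the bound.
  have hhor : ∀ ι : ℝ → ℝ, (∀ T, ι T ^ 2 = T ^ 2) →
      Tendsto (fun T : ℝ => ∫ x in a..b, f (x + ι T * Complex.I)) atTop (𝓝 0) := by
    intro ι hι
    have h1 : Tendsto (fun T : ℝ => C * (1 + T ^ 2)⁻¹ * |b - a|) atTop (𝓝 0) := by
      have : Tendsto (fun T : ℝ => (1 + T ^ 2)⁻¹) atTop (𝓝 0) :=
        tendsto_inv_atTop_zero.comp (tendsto_atTop_add_const_left _ _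
          (tendsto_pow_atTop two_ne_zero))
      simpa using (this.const_mul C).mul_const |b - a|
    refine squeeze_zero_norm (fun T => ?_) h1
    refine intervalIntegral.norm_integral_le_of_norm_le_const fun x hx => ?_
    rw [uIoc_of_le hab] at hx
    have := hC (x + ι T * Complex.I) (by simpa using hx.1.le) (by simpa using hx.2)
    simpa [hι T] using this
  have h1 := intervalIntegral_tendsto_integral (hint b hab le_rfl) tendsto_neg_atTop_atBot tendsto_id
  have h2 := intervalIntegral_tendsto_integral (hint a le_rfl hab) tendsto_neg_atTop_atBot tendsto_id
  have h3 := ((h1.sub h2).const_mul Complex.I)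
  have h4 := (hhor (fun T => T) fun _ => rfl).sub (hhor (fun T => -T) fun T => by ring)
  rw [sub_zero] at h4
  have h5 := tendsto_nhds_unique (h3.congr fun T => hrect T) h4
  exact (sub_eq_zero.1 ((mul_eq_zero.1 h5).resolve_left Complex.I_ne_zero)).symm

/-- A cube is all that is needed of the exponential growth: a numerator of linear growth divided by
it decays quadratically. -/
lemma abs_im_cube_le_norm_sin {s : ℂ} (hs : 1 ≤ |s.im|) :
    |s.im| ^ 3 ≤ ‖Complex.sin (Real.pi * s)‖ := by
  set x := Real.pi * |s.im| with hx
  have hpi := Real.pi_gt_d2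
  have hx3 : 3 ≤ x := by nlinarith
  have h1 : (Real.exp x - 1) / 2 ≤ ‖Complex.sin (Real.pi * s)‖ := by
    have e1 : ‖Complex.exp (-(Real.pi * s) * Complex.I)‖ = Real.exp (Real.pi * s.im) := by
      rw [Complex.norm_exp]; simp
    have e2 : ‖Complex.exp (Real.pi * s * Complex.I)‖ = Real.exp (-(Real.pi * s.im)) := by
      rw [Complex.norm_exp]; simp
    have h2 : ‖Complex.sin (Real.pi * s)‖ = ‖Complex.exp (-(Real.pi * s) * Complex.I) -
        Complex.exp (Real.pi * s * Complex.I)‖ / 2 := by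
      rw [Complex.sin, norm_div, norm_mul, Complex.norm_I, mul_one]
      simp
    rw [h2]
    have h3 := abs_norm_sub_norm_le (Complex.exp (-(Real.pi * s) * Complex.I))
      (Complex.exp (Real.pi * s * Complex.I))
    rw [e1, e2] at h3
    refine div_le_div_of_nonneg_right (le_trans ?_ h3) two_pos.le
    rcases abs_cases s.im with ⟨h4, h5⟩ | ⟨h4, h5⟩
    · rw [hx, h4]
      have : Real.exp (-(Real.pi * s.im)) ≤ 1 := Real.exp_le_one_iff.2 (by nlinarith)
      exact le_trans (by linarith) (le_abs_self _)
    · rw [hx, h4]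
      have : Real.exp (Real.pi * s.im) ≤ 1 := Real.exp_le_one_iff.2 (by nlinarith)
      rw [mul_neg]
      exact le_trans (by linarith) (neg_le_abs _)
  refine le_trans ?_ h1
  have h6 := Real.pow_div_factorial_le_exp x (by linarith) 4
  have h7 : (4 : ℝ) ≤ Real.exp x := by linarith [Real.add_one_le_exp x]
  have h8 : (Nat.factorial 4 : ℝ) = 24 := by norm_num [Nat.factorial]
  rw [h8] at h6
  -- Here 96 = 4 · 4!, so x^4 / 4! ≤ e^x gives 4 |Im s|^4 ≤ e^x, enough to absorb the -1 and the
  -- factor 1/2.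
  have h9 : 96 * |s.im| ^ 4 ≤ x ^ 4 := by
    rw [hx, mul_pow]
    have : (96 : ℝ) ≤ Real.pi ^ 4 := by
      calc (96 : ℝ) ≤ 3.14 ^ 4 := by norm_num
        _ ≤ _ := by gcongr
    gcongr
  have h10 : |s.im| ^ 3 ≤ |s.im| ^ 4 := pow_le_pow_right₀ hs (by norm_num)
  have h11 : 4 * |s.im| ^ 4 ≤ Real.exp x := by
    refine le_trans ?_ h6
    rw [le_div_iff₀ (by norm_num)]
    linarith
  have h12 : (1 : ℝ) ≤ |s.im| ^ 4 := one_le_pow₀ hs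
  linarith

/-- The zeros of `lam * sin (π s) - π` in the strip `0 < Re s < 2`. -/
lemma re_eq_half_of_sin_eq {lam : ℝ} (h0 : 0 < lam) (h1 : lam ≤ Real.pi) {s : ℂ} (hs0 : 0 < s.re)
    (hs2 : s.re < 2) (hs : lam * Complex.sin (Real.pi * s) - Real.pi = 0) : s.re = 1 / 2 := by
  have hsin : Complex.sin (Real.pi * s) = ((Real.pi / lam : ℝ) : ℂ) := by
    have : (lam : ℂ) ≠ 0 := by exact_mod_cast h0.ne'
    push_cast
    field_simp
    linear_combination hs
  have hpi := Real.pi_pos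
  -- λ ≤ π enters here. The real part sin(π Re s) cosh(π Im s) is then at least 1, so the sine is
  -- positive; the vanishing imaginary part gives cos(π Re s) = 0, directly or because sinh = 0
  -- forces the sine to be 1.
  have hge : 1 ≤ Real.pi / lam := by rw [le_div_iff₀ h0]; linarith
  rw [Complex.sin_eq] at hsin
  have hre := congrArg Complex.re hsin
  have him := congrArg Complex.im hsin
  have e1 : (Real.pi * s).re = Real.pi * s.re := by simp
  have e2 : (Real.pi * s).im = Real.pi * s.im := by simp
  rw [e1, e2] at hre him
  simp only [← Complex.ofReal_sin, ← Complex.ofReal_cos, ← Complex.ofReal_sinh,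
    ← Complex.ofReal_cosh, ← Complex.ofReal_mul, Complex.add_re, Complex.add_im, Complex.ofReal_re,
    Complex.ofReal_im, Complex.mul_re, Complex.mul_im, Complex.I_re, Complex.I_im, mul_zero,
    mul_one, add_zero, zero_add, sub_self] at hre him
  have hcosh := Real.one_le_cosh (Real.pi * s.im)
  have hsinpos : 0 < Real.sin (Real.pi * s.re) := by
    by_contra! hneg
    nlinarith
  have hcos : Real.cos (Real.pi * s.re) = 0 := by
    rcases mul_eq_zero.1 him with h | h
    · exact h
    · have h2 : Real.pi * s.im = 0 := Real.sinh_eq_zero.1 h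
      rw [h2, Real.cosh_zero, mul_one] at hre
      have h3 : Real.sin (Real.pi * s.re) = 1 := le_antisymm (Real.sin_le_one _) (by linarith)
      have := Real.sin_sq_add_cos_sq (Real.pi * s.re)
      rw [h3] at this
      nlinarith
  have hlt : s.re < 1 := by
    by_contra! hge1
    have h4 : Real.sin (Real.pi * s.re) ≤ 0 := by
      have := Real.sin_nonneg_of_nonneg_of_le_pi (x := Real.pi * s.re - Real.pi)
        (by nlinarith) (by nlinarith)
      rw [Real.sin_sub_pi] at this
      linarith
    linarith
  have h5 : Real.cos (Real.pi * s.re) = Real.cos (Real.pi / 2) := by rw [hcos, Real.cos_pi_div_two]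
  have h6 := Real.injOn_cos ⟨by positivity, by nlinarith⟩ ⟨by positivity, by linarith⟩ h5
  field_simp at h6
  linarith

lemma sin_pi_mul_ne_zero {s : ℂ} (h0 : 0 < s.re) (h2 : s.re < 2) (h1 : s ≠ 1) :
    Complex.sin (Real.pi * s) ≠ 0 := by
  intro h
  obtain ⟨k, hk⟩ := Complex.sin_eq_zero_iff.1 h
  have hpi : (Real.pi : ℂ) ≠ 0 := by exact_mod_cast Real.pi_pos.ne'
  have hsk : s = k := mul_left_cancel₀ hpi (by rw [hk]; ring)
  rw [hsk, Complex.intCast_re] at h0 h2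
  have h3 : (0 : ℤ) < k := by exact_mod_cast h0
  have h4 : k < (2 : ℤ) := by exact_mod_cast h2
  have : k = 1 := by omega
  exact h1 (by rw [hsk, this]; simp)

/-! ### Analytic continuation of the series and decay of the Cauchy sum -/

section

/-- The entire function `sin (π s) / (s - 1)`. -/
def sinQuot : ℂ → ℂ := dslope (fun s => Complex.sin (Real.pi * s)) 1

lemma differentiable_sinQuot : Differentiable ℂ sinQuot := by
  rw [← differentiableOn_univ, sinQuot, Complex.differentiableOn_dslope univ_mem]
  exact Differentiable.differentiableOn (by fun_prop)

lemma sin_pi_one : Complex.sin (Real.pi * (1 : ℂ)) = 0 := by simp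

lemma sub_one_mul_sinQuot (s : ℂ) : (s - 1) * sinQuot s = Complex.sin (Real.pi * s) := by
  have := sub_smul_dslope (fun s : ℂ => Complex.sin (Real.pi * s)) 1 s
  rw [sin_pi_one, sub_zero, smul_eq_mul] at this
  exact this

lemma sinQuot_one : sinQuot 1 = -Real.pi := by
  rw [sinQuot, dslope_same]
  have h : HasDerivAt (fun s : ℂ => Complex.sin (Real.pi * s))
      (Complex.cos (Real.pi * 1) * (Real.pi * 1)) 1 :=
    ((hasDerivAt_id (1 : ℂ)).const_mul (Real.pi : ℂ)).csin
  rw [h.deriv]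
  simp

lemma sinQuot_ne_zero {s : ℂ} (h0 : 0 < s.re) (h2 : s.re < 2) : sinQuot s ≠ 0 := by
  rcases eq_or_ne s 1 with rfl | h1
  · rw [sinQuot_one]
    exact_mod_cast neg_ne_zero.2 Real.pi_pos.ne'
  · intro h
    have := sub_one_mul_sinQuot s
    rw [h, mul_zero] at this
    exact sin_pi_mul_ne_zero h0 h2 h1 this.symm

lemma isOpen_strip : IsOpen {s : ℂ | 0 < s.re ∧ s.re < 2} :=
  (isOpen_lt continuous_const Complex.continuous_re).inter
    (isOpen_lt Complex.continuous_re continuous_const)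

variable {α : ℕ → ℂ}

/-- Growth of order (1/2 - Re s)^(-1/2) is slower than that of a simple pole, which rules out poles
on the line Re s = 1/2. -/
lemma norm_lgSeries_sq_le (hα : Summable fun i : ℕ => (i + 2 : ℝ) * ‖α i‖ ^ 2) {s : ℂ}
    (h0 : 0 ≤ s.re) (h1 : s.re < 1 / 2) :
    ‖lgSeries α s‖ ^ 2 ≤ (∑' i : ℕ, (i + 2 : ℝ) * ‖α i‖ ^ 2) * (4 / (1 - 2 * s.re)) := by
  refine le_trans (pow_le_pow_left₀ (norm_nonneg _) ?_ 2) (tsum_norm_mul_lg_rpow_sq_le hα h0 h1)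
  exact tsum_of_norm_bounded (summable_norm_mul_lg_rpow hα h0 h1).hasSum fun i => by
    rw [norm_mul, norm_lg_cpow]

/-- The series `∑ α_i (lg i)^(s - 1)` of a solution extends analytically to the strip
`0 < Re s < 2`. -/
lemma exists_lgSeries_extension (hα : Summable fun i : ℕ => (i + 2 : ℝ) * ‖α i‖ ^ 2) {lam : ℝ}
    (hl0 : 0 < lam) (hl1 : lam ≤ Real.pi) {c : ℂ}
    (heq : ∀ i : ℕ, lam * ((i + 2) * α i) = cauchySum α (lg i) - c / (lg i : ℂ)) :
    ∃ (A : ℂ → ℂ) (C T : ℝ), 0 ≤ C ∧ 1 ≤ T ∧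
      DifferentiableOn ℂ A {s | 0 < s.re ∧ s.re < 2} ∧
      (∀ s : ℂ, 0 < s.re → s.re < 1 / 2 → A s = lgSeries α s) ∧ A 1 = c ∧
      ∀ s : ℂ, 1 / 4 ≤ s.re → s.re ≤ 5 / 4 → T ≤ |s.im| → ‖A s‖ ≤ C * |s.im| := by
  obtain ⟨G, C, hC0, hGd, hGb, hGe⟩ := exists_lgSeries_equation hα heq
  have hpi := Real.pi_pos
  have hlg0 : (lg 0 : ℂ) ≠ 0 := by exact_mod_cast (lg_pos 0).ne'
  -- The functional equation multiplied by sin πs; `sinQuot` absorbs the pole of 1 / (1 - s).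
  set f : ℂ → ℂ := fun s => Complex.sin (Real.pi * s) * G s + c * (lg 0 : ℂ) ^ (s - 1) * sinQuot s
    with hf
  set g : ℂ → ℂ := fun s => lam * Complex.sin (Real.pi * s) - Real.pi with hg
  have hfd : DifferentiableOn ℂ f {s | 0 < s.re ∧ s.re < 2} := by
    refine (DifferentiableOn.mul (Differentiable.differentiableOn (by fun_prop)) hGd).add
      (Differentiable.differentiableOn ?_)
    refine Differentiable.mul (Differentiable.const_mul (fun s => ?_) _) differentiable_sinQuot
    exact (differentiableAt_id.sub_const 1).const_cpow (Or.inl hlg0)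
  have hgd : Differentiable ℂ g := by fun_prop
  have hB : ∀ s : ℂ, 0 < s.re → s.re < 1 / 2 → g s * lgSeries α s = f s := by
    intro s h0 h1
    have hs1 : s ≠ 1 := by rintro rfl; norm_num at h1
    have hsin := sin_pi_mul_ne_zero h0 (by linarith) hs1
    have h2 := hGe s h0 h1
    have h3 := sub_one_mul_sinQuot s
    have h4 : 1 - s ≠ 0 := sub_ne_zero.2 hs1.symm
    have h5 : sinQuot s = -Complex.sin (Real.pi * s) / (1 - s) := by
      rw [← h3]; field_simp; ring
    simp only [hf, hg]
    rw [h5]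
    calc (lam * Complex.sin (Real.pi * s) - Real.pi) * lgSeries α s
        = Complex.sin (Real.pi * s) * (lam * lgSeries α s) - Real.pi * lgSeries α s := by ring
      _ = _ := by rw [h2]; field_simp; ring
  have hgne : ∀ s : ℂ, 0 < s.re → s.re < 2 → s.re ≠ 1 / 2 → g s ≠ 0 := fun s h0 h2 h1 h =>
    h1 (re_eq_half_of_sin_eq hl0 hl1 h0 h2 h)
  have hB' : ∀ s : ℂ, 0 < s.re → s.re < 1 / 2 → f s / g s = lgSeries α s := fun s h0 h1 => by
    rw [← hB s h0 h1, mul_div_cancel_left₀ _ (hgne s h0 (by linarith) h1.ne)]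
  have hsmall : ∀ᶠ ε : ℝ in 𝓝[>] 0, ε ∈ Ioo (0 : ℝ) (1 / 2) :=
    Ioo_mem_nhdsGT (by norm_num)
  obtain ⟨A, hAd, hA⟩ := exists_differentiableOn_quotient isOpen_strip hfd hgd.differentiableOn
    (fun z hz hgz => by
      have hre := re_eq_half_of_sin_eq hl0 hl1 hz.1 hz.2 hgz
      filter_upwards [hsmall] with ε hε
      have : (z - ε).re = 1 / 2 - ε := by simp [hre]
      exact hgne _ (by rw [this]; linarith [hε.2]) (by rw [this]; linarith [hε.1])
        (by rw [this]; linarith [hε.1]))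
    (fun z hz hgz => by
      have hre := re_eq_half_of_sin_eq hl0 hl1 hz.1 hz.2 hgz
      set S := ∑' i : ℕ, (i + 2 : ℝ) * ‖α i‖ ^ 2
      have hlim : Tendsto (fun ε : ℝ => √(2 * S * ε)) (𝓝[>] 0) (𝓝 0) := by
        have : Continuous fun ε : ℝ => √(2 * S * ε) := by fun_prop
        have h1 := this.tendsto 0
        simp only [mul_zero, Real.sqrt_zero] at h1
        exact h1.mono_left nhdsWithin_le_nhds
      refine squeeze_zero_norm' ?_ hlim
      filter_upwards [hsmall] with ε hε
      have hr : (z - ε).re = 1 / 2 - ε := by simp [hre]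
      have h0 : 0 < (z - ε).re := by rw [hr]; linarith [hε.2]
      have h1 : (z - ε).re < 1 / 2 := by rw [hr]; linarith [hε.1]
      rw [hB' _ h0 h1]
      refine Real.le_sqrt_of_sq_le ?_
      have h2 := norm_lgSeries_sq_le hα h0.le h1
      have hε0 := hε.1
      -- The bound on ε ‖B(z - ε)‖ is of order √ε whatever the order of the zero of g, so the double
      -- zero at 1/2 for λ = π is covered.
      rw [hr, show 1 - 2 * (1 / 2 - ε) = 2 * ε by ring] at h2
      rw [norm_mul, Complex.norm_real, Real.norm_of_nonneg hε0.le, mul_pow]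
      calc ε ^ 2 * ‖lgSeries α (z - ε)‖ ^ 2 ≤ ε ^ 2 * (S * (4 / (2 * ε))) := by gcongr
        _ = 2 * S * ε := by field_simp; ring)
  -- Above height T, |sin πs| ≥ |Im s| ≥ 2π / λ, so |λ sin πs - π| is at least half of λ |sin πs|;
  -- this yields the factor 2 / λ.
  refine ⟨A, (2 / lam) * (3 * C + 4 * ‖c‖), max 1 (2 * Real.pi / lam), by positivity,
    le_max_left _ _, hAd, ?_, ?_, ?_⟩
  · intro s h0 h1
    rw [← hB' s h0 h1, ← hA s ⟨h0, by linarith⟩,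
      mul_div_cancel_left₀ _ (hgne s h0 (by linarith) h1.ne)]
  -- At s = 1 the equation reads -π A(1) = -π c.
  · have h1 := hA 1 (by simp)
    simp only [hf, hg, sinQuot_one, sub_self, Complex.cpow_zero, mul_one, Complex.sin_pi, mul_zero,
      zero_mul, zero_add, zero_sub] at h1
    have : (Real.pi : ℂ) ≠ 0 := by exact_mod_cast hpi.ne'
    have h2 : (Real.pi : ℂ) * (A 1 - c) = 0 := by linear_combination -h1
    exact sub_eq_zero.1 ((mul_eq_zero.1 h2).resolve_left this)
  · intro s h0 h1 hT
    have ht1 : 1 ≤ |s.im| := (le_max_left _ _).trans hT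
    have ht2 : 2 * Real.pi / lam ≤ |s.im| := (le_max_right _ _).trans hT
    have hm := abs_im_cube_le_norm_sin ht1
    set m := ‖Complex.sin (Real.pi * s)‖ with hmdef
    have hm1 : |s.im| ≤ m := le_trans (by nlinarith [mul_self_nonneg (|s.im| - 1), sq_nonneg |s.im|]) hm
    have hmpos : 0 < m := by linarith
    have h3 : 2 * Real.pi ≤ lam * m := by
      rw [div_le_iff₀ hl0] at ht2
      nlinarith
    have hgl : lam * m / 2 ≤ ‖g s‖ := by
      have := norm_sub_norm_le ((lam : ℂ) * Complex.sin (Real.pi * s)) (Real.pi : ℂ)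
      rw [norm_mul, Complex.norm_real, Complex.norm_real, Real.norm_of_nonneg hl0.le,
        Real.norm_of_nonneg hpi.le] at this
      simp only [hg]
      linarith
    have him : |s.im| ≤ ‖s - 1‖ := by
      have := Complex.abs_im_le_norm (s - 1)
      simpa using this
    have hn1 : ‖s - 1‖ ≤ 1 + |s.im| := by
      have := Complex.norm_le_abs_re_add_abs_im (s - 1)
      simp only [Complex.sub_re, Complex.one_re, Complex.sub_im, Complex.one_im, sub_zero] at this
      have h5 : |s.re - 1| ≤ 1 := by rw [abs_le]; constructor <;> linarith
      linarith
    have hS : ‖sinQuot s‖ ≤ m := by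
      have h6 := congrArg norm (sub_one_mul_sinQuot s)
      rw [norm_mul] at h6
      nlinarith [norm_nonneg (sinQuot s)]
    have hpw : ‖(lg 0 : ℂ) ^ (s - 1)‖ ≤ 4 := by
      refine (norm_ofReal_cpow_le (half_le_lg 0) (by simp; linarith) (by simp; linarith)).trans ?_
      linarith [lg_zero_le_one]
    have hfu : ‖f s‖ ≤ m * ((3 * C + 4 * ‖c‖) * |s.im|) := by
      simp only [hf]
      refine (norm_add_le _ _).trans ?_
      rw [norm_mul, norm_mul, norm_mul, ← hmdef]
      have h7 : ‖G s‖ ≤ C * (3 * |s.im|) := (hGb s h0 h1).trans (by gcongr; linarith)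
      calc m * ‖G s‖ + ‖c‖ * ‖(lg 0 : ℂ) ^ (s - 1)‖ * ‖sinQuot s‖
          ≤ m * (C * (3 * |s.im|)) + ‖c‖ * 4 * m := by gcongr
        _ ≤ m * (C * (3 * |s.im|)) + ‖c‖ * 4 * m * |s.im| := by
            have : 0 ≤ ‖c‖ * 4 * m := by positivity
            nlinarith
        _ = _ := by ring
    have h8 := congrArg norm (hA s ⟨by linarith, by linarith⟩)
    rw [norm_mul] at h8
    have h9 : lam * m / 2 * ‖A s‖ ≤ m * ((3 * C + 4 * ‖c‖) * |s.im|) := by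
      refine le_trans ?_ hfu
      rw [← h8]
      gcongr
    have h10 : 0 < lam * m / 2 := by positivity
    rw [← le_div_iff₀' h10] at h9
    refine h9.trans (le_of_eq ?_)
    field_simp

/-- The Mellin transform of the Cauchy sum of a solution, corrected by `c / (1 + y)`, extends to a
strip around `Re s = 1` with quadratic decay. -/
lemma exists_mellin_extension (hα : Summable fun i : ℕ => (i + 2 : ℝ) * ‖α i‖ ^ 2) {lam : ℝ}
    (hl0 : 0 < lam) (hl1 : lam ≤ Real.pi) {c : ℂ}
    (heq : ∀ i : ℕ, lam * ((i + 2) * α i) = cauchySum α (lg i) - c / (lg i : ℂ)) :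
    ∃ (h : ℂ → ℂ) (C : ℝ), DifferentiableOn ℂ h {s | 0 < s.re ∧ s.re < 2} ∧
      (∀ s : ℂ, 0 < s.re → s.re < 1 / 2 →
        h s = (lgSeries α s - c) * (Real.pi / Complex.sin (Real.pi * s))) ∧
      ∀ s : ℂ, 1 / 4 ≤ s.re → s.re ≤ 5 / 4 → ‖h s‖ ≤ C * (1 + s.im ^ 2)⁻¹ := by
  obtain ⟨A, C, T, hC, hT, hAd, hAB, hA1, hAb⟩ := exists_lgSeries_extension hα hl0 hl1 heq
  have hpi := Real.pi_pos
  -- Since A(1) = c, this is (A - c) π / sin πs with the zero of the sine at 1 cancelled.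
  set h : ℂ → ℂ := fun s => Real.pi * dslope A 1 s / sinQuot s with hh
  have hval : ∀ s : ℂ, 0 < s.re → s.re < 2 → s ≠ 1 →
      h s = (A s - c) * (Real.pi / Complex.sin (Real.pi * s)) := by
    intro s h0 h2 h1
    have h3 : s - 1 ≠ 0 := sub_ne_zero.2 h1
    have h4 := sinQuot_ne_zero h0 h2
    simp only [hh]
    rw [dslope_of_ne _ h1, slope_def_field, hA1, ← sub_one_mul_sinQuot]
    field_simp
  have hd : DifferentiableOn ℂ h {s | 0 < s.re ∧ s.re < 2} := by
    refine DifferentiableOn.div (DifferentiableOn.const_mul ?_ _)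
      differentiable_sinQuot.differentiableOn fun s hs => sinQuot_ne_zero hs.1 hs.2
    exact (Complex.differentiableOn_dslope (isOpen_strip.mem_nhds (by simp))).2 hAd
  have hcomp : IsCompact (Icc (1 / 4 : ℝ) (5 / 4) ×ℂ Icc (-T) T) := isCompact_Icc.reProdIm isCompact_Icc
  obtain ⟨C2, hC2⟩ := hcomp.exists_bound_of_continuousOn (f := h)
    (hd.continuousOn.mono fun s hs => ⟨by linarith [hs.1.1], by linarith [hs.1.2]⟩)
  refine ⟨h, max (C2 * (1 + T ^ 2)) (8 * (C + ‖c‖)), hd, ?_, ?_⟩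
  · intro s h0 h1
    rw [hval s h0 (by linarith) (by rintro rfl; norm_num at h1), hAB s h0 h1]
  · intro s h0 h1
    have hpos : 0 < 1 + s.im ^ 2 := by positivity
    rw [← div_eq_mul_inv, le_div_iff₀ hpos]
    rcases le_or_gt |s.im| T with ht | ht
    · refine le_trans ?_ (le_max_left _ _)
      have h3 := hC2 s ⟨⟨h0, h1⟩, abs_le.1 ht⟩
      have h4 : s.im ^ 2 ≤ T ^ 2 := sq_le_sq' (by linarith [(abs_le.1 ht).1]) (abs_le.1 ht).2
      have := (norm_nonneg _).trans h3
      gcongr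
    · refine le_trans ?_ (le_max_right _ _)
      have ht1 : 1 ≤ |s.im| := hT.trans ht.le
      have hs1 : s ≠ 1 := by rintro rfl; norm_num at ht1
      have hm := abs_im_cube_le_norm_sin ht1
      rw [hval s (by linarith) (by linarith) hs1, norm_mul, norm_div, Complex.norm_real,
        Real.norm_of_nonneg hpi.le]
      have h5 : ‖A s - c‖ ≤ (C + ‖c‖) * |s.im| := by
        refine (norm_sub_le _ _).trans ?_
        nlinarith [hAb s h0 h1 ht.le, norm_nonneg c]
      have h6 : Real.pi / ‖Complex.sin (Real.pi * s)‖ ≤ 4 / |s.im| ^ 3 := by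
        have := Real.pi_le_four
        gcongr
      have h7 : 1 + s.im ^ 2 ≤ 2 * |s.im| ^ 2 := by
        have := sq_abs s.im
        nlinarith
      have hp : 0 < |s.im| := by linarith
      calc ‖A s - c‖ * (Real.pi / ‖Complex.sin (Real.pi * s)‖) * (1 + s.im ^ 2)
          ≤ ((C + ‖c‖) * |s.im|) * (4 / |s.im| ^ 3) * (2 * |s.im| ^ 2) := by gcongr
        _ = 8 * (C + ‖c‖) := by field_simp; ring

/-- The decay of the Cauchy sum of a solution. -/
lemma exists_norm_cauchySum_sub_le (hα : Summable fun i : ℕ => (i + 2 : ℝ) * ‖α i‖ ^ 2) {lam : ℝ}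
    (hl0 : 0 < lam) (hl1 : lam ≤ Real.pi) {c : ℂ}
    (heq : ∀ i : ℕ, lam * ((i + 2) * α i) = cauchySum α (lg i) - c / (lg i : ℂ)) :
    ∃ C : ℝ, 0 ≤ C ∧ ∀ y : ℝ, 0 < y →
      ‖cauchySum α y - c * ((1 + y : ℝ) : ℂ)⁻¹‖ ≤ C * y ^ (-(5 / 4) : ℝ) := by
  obtain ⟨h, C, hd, hval, hb⟩ := exists_mellin_extension hα hl0 hl1 heq
  have hK := summable_norm_div_lg hα
  have hC0 : 0 ≤ C := by
    have := (norm_nonneg _).trans (hb 1 (by norm_num) (by norm_num))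
    simpa using this
  -- The correction is c / (1 + y) instead of c / y because its Mellin transform exists in 0 < Re s
  -- < 1 and equals c π / sin πs.
  set v : ℝ → ℂ := fun y => cauchySum α y - c * ((1 + y : ℝ) : ℂ)⁻¹ with hv
  have hmel : ∀ s : ℂ, 0 < s.re → s.re < 1 / 2 → MellinConvergent v s ∧ mellin v s = h s := by
    intro s h0 h1
    have h2 := hasMellin_sub (mellinConvergent_cauchySum hα h0 h1)
      ((mellinConvergent_inv_one_add h0 (by linarith : s.re < 1)).const_smul c)
    have h3 := mellin_const_smul (fun t : ℝ => ((1 + t : ℝ) : ℂ)⁻¹) s c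
    refine ⟨h2.1, h2.2.trans ?_⟩
    rw [mellin_cauchySum hα h0 h1, h3, mellin_inv_one_add h0 (by linarith), hval s h0 h1,
      smul_eq_mul]
    ring
  have hcont : ∀ x : ℝ, 1 / 4 ≤ x → x ≤ 5 / 4 → Continuous fun t : ℝ => h (x + t * Complex.I) := by
    intro x h0 h1
    refine hd.continuousOn.comp_continuous (by fun_prop) fun t => ?_
    simp
    constructor <;> linarith
  refine ⟨1 / (2 * Real.pi) * (C * ∫ t : ℝ, (1 + t ^ 2)⁻¹), ?_, fun y hy => ?_⟩
  · have : 0 ≤ ∫ t : ℝ, (1 + t ^ 2)⁻¹ := integral_nonneg fun t => by positivity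
    have := Real.pi_pos
    positivity
  have hyc : (y : ℂ) ≠ 0 := by exact_mod_cast hy.ne'
  have h14 : ∀ t : ℝ, mellin v ((1 / 4 : ℝ) + t * Complex.I) = h ((1 / 4 : ℝ) + t * Complex.I) :=
    fun t => (hmel _ (by simp) (by simp; norm_num)).2
  have hinv : mellinInv (1 / 4) (mellin v) y = v y := by
    refine mellinInv_mellin_eq _ _ hy (hmel _ (by simp) (by simp; norm_num)).1 ?_ ?_
    · refine Integrable.congr ?_ (Eventually.of_forall fun t => (h14 t).symm)
      refine (integrable_inv_one_add_sq.const_mul C).mono'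
        (hcont _ le_rfl (by norm_num)).aestronglyMeasurable (Eventually.of_forall fun t => ?_)
      simpa using hb ((1 / 4 : ℝ) + t * Complex.I) (by simp) (by simp; norm_num)
    · refine ContinuousAt.sub ((continuousOn_cauchySum hK).continuousAt (Ici_mem_nhds hy)) ?_
      refine continuousAt_const.mul (ContinuousAt.inv₀ (by fun_prop) ?_)
      exact_mod_cast (by positivity : (1 + y : ℝ) ≠ 0)
  set F : ℂ → ℂ := fun s => (y : ℂ) ^ (-s) * h s with hF
  have hnorm : ∀ s : ℂ, ‖(y : ℂ) ^ (-s)‖ = y ^ (-s.re) := fun s => by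
    rw [Complex.norm_cpow_eq_rpow_re_of_pos hy, Complex.neg_re]
  -- No singularity lies between the two lines, and |y^(-s)| = y^(-5/4) on the new one. Any abscissa
  -- strictly between 1 and 2 would serve.
  have hshift : ∫ t : ℝ, F ((1 / 4 : ℝ) + t * Complex.I) = ∫ t : ℝ, F ((5 / 4 : ℝ) + t * Complex.I) := by
    refine integral_vertical_eq (C := (y ^ (-(1 / 4) : ℝ) + y ^ (-(5 / 4) : ℝ)) * C) (by norm_num)
      ?_ ?_
    · refine DifferentiableOn.mul (Differentiable.differentiableOn fun s => ?_)
        (hd.mono fun s hs => ⟨by linarith [hs.1], by linarith [hs.2]⟩)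
      exact differentiableAt_id.neg.const_cpow (Or.inl hyc)
    · intro s h0 h1
      rw [norm_mul, hnorm, mul_assoc]
      have h2 : y ^ (-s.re) ≤ y ^ (-(1 / 4) : ℝ) + y ^ (-(5 / 4) : ℝ) := by
        have p1 := Real.rpow_nonneg hy.le (-(1 / 4))
        have p2 := Real.rpow_nonneg hy.le (-(5 / 4))
        rcases le_total 1 y with h3 | h3
        · exact (Real.rpow_le_rpow_of_exponent_le h3 (by linarith)).trans (le_add_of_nonneg_right p2)
        · exact (Real.rpow_le_rpow_of_exponent_ge hy h3 (by linarith)).trans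
            (le_add_of_nonneg_left p1)
      gcongr
      exact hb s h0 h1
  have hvy : v y = (1 / (2 * Real.pi) : ℝ) • ∫ t : ℝ, F ((5 / 4 : ℝ) + t * Complex.I) := by
    rw [← hinv, mellinInv, ← hshift]
    congr 1
    refine integral_congr_ae (Eventually.of_forall fun t => ?_)
    simp only [hF, smul_eq_mul]
    rw [h14]
  change ‖v y‖ ≤ _
  rw [hvy, norm_smul, Real.norm_of_nonneg (by have := Real.pi_pos; positivity), mul_assoc]
  have hpi := Real.pi_pos
  gcongr
  have h4 : ‖∫ t : ℝ, F ((5 / 4 : ℝ) + t * Complex.I)‖ ≤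
      ∫ t : ℝ, y ^ (-(5 / 4) : ℝ) * (C * (1 + t ^ 2)⁻¹) := by
    refine norm_integral_le_of_norm_le
      ((integrable_inv_one_add_sq.const_mul C).const_mul _) (Eventually.of_forall fun t => ?_)
    have e : (((5 / 4 : ℝ) : ℂ) + t * Complex.I).re = 5 / 4 := by simp
    have e2 : (((5 / 4 : ℝ) : ℂ) + t * Complex.I).im = t := by simp
    have h5 := hb ((5 / 4 : ℝ) + t * Complex.I) (by rw [e]; norm_num) e.le
    rw [e2] at h5
    simp only [hF]
    rw [norm_mul, hnorm, e]
    gcongr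
  refine h4.trans (le_of_eq ?_)
  rw [integral_const_mul, integral_const_mul]
  ring

end

/-! ### The rank-one identity and uniqueness for the Cauchy matrix -/

section

variable {α : ℕ → ℂ}

lemma norm_mul_lg_div (i : ℕ) : ‖α i * (lg i : ℂ)‖ / lg i = ‖α i‖ := by
  rw [norm_mul, Complex.norm_real, Real.norm_of_nonneg (lg_pos i).le,
    mul_div_cancel_right₀ _ (lg_pos i).ne']

/-- Multiplication by `lg` anticommutes with the matrix `1 / (lg i + lg j)` up to a matrix of
rank one. -/
lemma two_mul_re_tsum_conj_mul_cauchySum (hα : Summable fun i => ‖α i‖) :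
    2 * (∑' i, conj (α i) * cauchySum (fun j => α j * lg j) (lg i)).re = ‖∑' i, α i‖ ^ 2 := by
  set t : ℕ × ℕ → ℂ := fun p =>
    conj (α p.1) * (α p.2 * lg p.2 * ((lg p.2 + lg p.1 : ℝ) : ℂ)⁻¹) with ht
  have hprod : Summable fun p : ℕ × ℕ => ‖α p.1‖ * ‖α p.2‖ :=
    hα.mul_of_nonneg hα (fun _ => norm_nonneg _) fun _ => norm_nonneg _
  have htn : ∀ p, ‖t p‖ ≤ ‖α p.1‖ * ‖α p.2‖ := fun p => by
    have h1 := lg_pos p.1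
    have h2 := lg_pos p.2
    simp only [ht]
    rw [norm_mul, norm_mul, norm_mul, RCLike.norm_conj, norm_inv_lg_add h1.le, Complex.norm_real,
      Real.norm_of_nonneg h2.le, mul_assoc ‖α p.2‖]
    have : lg p.2 * (lg p.2 + lg p.1)⁻¹ ≤ 1 := by
      rw [← div_eq_mul_inv, div_le_one (by positivity)]
      linarith
    gcongr
    nlinarith [norm_nonneg (α p.2)]
  have hts : Summable t := Summable.of_norm_bounded hprod htn
  have hY : ∑' p, t p = ∑' i, conj (α i) * cauchySum (fun j => α j * lg j) (lg i) := by
    rw [hts.tsum_prod]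
    refine tsum_congr fun i => ?_
    rw [cauchySum, ← tsum_mul_left]
  -- This is d_j/(d_i + d_j) + d_i/(d_i + d_j) = 1, where d_i = lg i.
  have hswap : ∀ p : ℕ × ℕ, t p + conj (t p.swap) = conj (α p.1) * α p.2 := fun p => by
    have h1 := lg_pos p.1
    have h2 := lg_pos p.2
    have h3 : ((lg p.1 + lg p.2 : ℝ) : ℂ) ≠ 0 := by exact_mod_cast (by positivity : lg p.1 + lg p.2 ≠ 0)
    simp only [ht, Prod.fst_swap, Prod.snd_swap, map_mul, Complex.conj_conj, Complex.conj_ofReal,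
      map_inv₀]
    rw [add_comm (lg p.2) (lg p.1)]
    field_simp
    push_cast
    ring
  have hswaps : Summable fun p : ℕ × ℕ => conj (t p.swap) :=
    Complex.summable_conj.2 ((Equiv.prodComm ℕ ℕ).summable_iff.2 hts)
  have h1 := hts.tsum_add hswaps
  have h2 : ∑' p : ℕ × ℕ, conj (t p.swap) = conj (∑' p, t p) := by
    rw [Complex.conj_tsum]
    exact (Equiv.prodComm ℕ ℕ).tsum_eq (fun p => conj (t p))
  have hcn : Summable fun i => ‖conj (α i)‖ := by simpa only [RCLike.norm_conj] using hα
  have h3 : ∑' p : ℕ × ℕ, conj (α p.1) * α p.2 = conj (∑' i, α i) * ∑' i, α i := by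
    rw [Complex.conj_tsum]
    exact (tsum_mul_tsum_of_summable_norm hcn hα).symm
  simp_rw [hswap] at h1
  rw [h2, h3, hY, Complex.add_conj, ← Complex.normSq_eq_conj_mul_self] at h1
  have h4 := congrArg Complex.re h1
  rw [Complex.ofReal_re, Complex.ofReal_re, Complex.normSq_eq_norm_sq] at h4
  exact h4.symm

/-- Termwise, d/(d + y) + y/(d + y) = 1. It passes from the Cauchy sum of α to that of α · lg at the
cost of a constant. -/
lemma cauchySum_mul_lg_add (hα : Summable fun i => ‖α i‖) {y : ℝ} (hy : 0 ≤ y) :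
    cauchySum (fun j => α j * lg j) y + y * cauchySum α y = ∑' i, α i := by
  have h1 : Summable fun i => ‖α i * (lg i : ℂ)‖ / lg i := by simpa only [norm_mul_lg_div] using hα
  have h2 : Summable fun i => ‖α i‖ / lg i := by
    refine Summable.of_nonneg_of_le (fun i => div_nonneg (norm_nonneg _) (lg_pos i).le)
      (fun i => ?_) (hα.mul_left 2)
    rw [div_le_iff₀ (lg_pos i)]
    nlinarith [half_le_lg i, norm_nonneg (α i)]
  rw [cauchySum, cauchySum, ← tsum_mul_left, ← (summable_cauchyTerm h1 hy).tsum_add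
    ((summable_cauchyTerm h2 hy).mul_left _)]
  refine tsum_congr fun i => ?_
  have h3 := lg_pos i
  have : ((lg i + y : ℝ) : ℂ) ≠ 0 := by exact_mod_cast (by positivity : lg i + y ≠ 0)
  field_simp
  push_cast
  ring

lemma tendsto_mul_cauchySum (hα : Summable fun i => ‖α i‖) :
    Tendsto (fun y : ℝ => (y : ℂ) * cauchySum α y) atTop (𝓝 (∑' i, α i)) := by
  have h : Tendsto (fun y : ℝ => ∑' i, α i * ((y / (lg i + y) : ℝ) : ℂ)) atTop (𝓝 (∑' i, α i)) := by
    refine tendsto_tsum_of_dominated_convergence hα (fun i => ?_) ?_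
    · have h1 : Tendsto (fun y : ℝ => y / (lg i + y)) atTop (𝓝 1) := by
        have h2 : Tendsto (fun y : ℝ => 1 - lg i * (lg i + y)⁻¹) atTop (𝓝 (1 - lg i * 0)) :=
          tendsto_const_nhds.sub ((tendsto_inv_atTop_zero.comp
            (tendsto_atTop_add_const_left _ _ tendsto_id)).const_mul _)
        rw [mul_zero, sub_zero] at h2
        refine h2.congr' ?_
        filter_upwards [eventually_gt_atTop 0] with y hy
        have := lg_pos i
        field_simp
        ring
      simpa using ((Complex.continuous_ofReal.tendsto 1).comp h1).const_mul (α i)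
    · filter_upwards [eventually_gt_atTop 0] with y hy i
      have := lg_pos i
      rw [norm_mul, Complex.norm_real, Real.norm_of_nonneg (by positivity)]
      refine mul_le_of_le_one_right (norm_nonneg _) ?_
      rw [div_le_one (by positivity)]
      linarith
  refine h.congr fun y => ?_
  rw [cauchySum, ← tsum_mul_left]
  refine tsum_congr fun i => ?_
  push_cast
  ring

/-- The equation `(H - lam) f = c ψ`, written in terms of `α_i = a_n / √n` with `n = i + 2`, has
only the trivial solution. -/
theorem eq_zero_of_cauchySum_equation (hα : Summable fun i : ℕ => (i + 2 : ℝ) * ‖α i‖ ^ 2)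
    {lam : ℝ} (hl0 : 0 < lam) (hl1 : lam ≤ Real.pi) {c : ℂ}
    (heq : ∀ i : ℕ, lam * ((i + 2) * α i) = cauchySum α (lg i) - c / (lg i : ℂ)) :
    (∀ i, α i = 0) ∧ c = 0 := by
  obtain ⟨C, hC0, hC⟩ := exists_norm_cauchySum_sub_le hα hl0 hl1 heq
  -- c/y and c/(1 + y) differ by c/(y(1 + y)) = O(y^(-5/4)), so the decay estimate also holds with
  -- c/y.
  have hsplit : ∀ y : ℝ, 0 < y → c / (y : ℂ) =
      c * ((1 + y : ℝ) : ℂ)⁻¹ + c * ((1 / (y * (1 + y)) : ℝ) : ℂ) := fun y hy => by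
    have h1 : (y : ℂ) ≠ 0 := by exact_mod_cast hy.ne'
    have h2 : (1 + y : ℂ) ≠ 0 := by exact_mod_cast (by positivity : (1 + y : ℝ) ≠ 0)
    push_cast
    field_simp
    ring
  have hu : ∀ y : ℝ, 0 < y →
      ‖cauchySum α y - c / (y : ℂ)‖ ≤ (C + ‖c‖) * y ^ (-(5 / 4) : ℝ) := by
    intro y hy
    have h1 : 1 / (y * (1 + y)) ≤ y ^ (-(5 / 4) : ℝ) := by
      have h2 : y ^ (1 / 4 : ℝ) ≤ 1 + y :=
        (Real.rpow_le_rpow hy.le (by linarith : y ≤ 1 + y) (by norm_num)).trans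
          ((Real.rpow_le_rpow_of_exponent_le (by linarith) (by norm_num : (1 / 4 : ℝ) ≤ 1)).trans
            (Real.rpow_one _).le)
      have h3 : y ^ (5 / 4 : ℝ) = y * y ^ (1 / 4 : ℝ) := by
        rw [← Real.rpow_one_add' hy.le (by norm_num)]
        norm_num
      have h4 := Real.rpow_pos_of_pos hy (1 / 4)
      rw [Real.rpow_neg hy.le, h3, ← one_div]
      gcongr
    rw [hsplit y hy, ← sub_sub, add_mul]
    refine (norm_sub_le _ _).trans (add_le_add (hC y hy) ?_)
    rw [norm_mul, Complex.norm_real, Real.norm_of_nonneg (by positivity)]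
    gcongr
  -- By the equation, λ n |α_i| is at most a constant times (log n)^(-5/4); the exponent exceeds 1,
  -- so the series converges.
  have hsum : Summable fun i => ‖α i‖ := by
    have h1 : Summable fun i : ℕ => 1 / ((i + 2 : ℝ) * lg i ^ (1 + 1 / 4 : ℝ)) :=
      summable_of_sum_range_le (fun i => by
        have := Real.rpow_nonneg (lg_pos i).le (1 + 1 / 4)
        positivity) (sum_inv_lg_rpow_le (q := 1 / 4) (by norm_num) (by norm_num))
    refine Summable.of_nonneg_of_le (fun _ => norm_nonneg _) (fun i => ?_)
      (h1.mul_left ((C + ‖c‖) / lam))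
    have h2 := hu (lg i) (lg_pos i)
    have hi : (0 : ℝ) < (i : ℝ) + 2 := by positivity
    have hin : ‖(i : ℂ) + 2‖ = (i : ℝ) + 2 := by
      rw [← Real.norm_of_nonneg hi.le, ← Complex.norm_real]
      push_cast
      rfl
    rw [← heq i, norm_mul, norm_mul, Complex.norm_real, Real.norm_of_nonneg hl0.le, hin,
      Real.rpow_neg (lg_pos i).le] at h2
    have h3 := Real.rpow_pos_of_pos (lg_pos i) (5 / 4)
    rw [show (1 + 1 / 4 : ℝ) = 5 / 4 by norm_num, ← mul_div_assoc, mul_one,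
      le_div_iff₀ (by positivity), le_div_iff₀ hl0]
    rw [← div_eq_mul_inv, le_div_iff₀ h3] at h2
    linarith
  have hc : ∑' i, α i = c := by
    refine tendsto_nhds_unique (tendsto_mul_cauchySum hsum) ?_
    have h1 : Tendsto (fun y : ℝ => (y : ℂ) * (cauchySum α y - c / (y : ℂ))) atTop (𝓝 0) := by
      have h2 : Tendsto (fun y : ℝ => (C + ‖c‖) * y ^ (-(1 / 4) : ℝ)) atTop (𝓝 0) := by
        simpa using (tendsto_rpow_neg_atTop (by norm_num : (0 : ℝ) < 1 / 4)).const_mul (C + ‖c‖)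
      refine squeeze_zero_norm' ?_ h2
      filter_upwards [eventually_gt_atTop 0] with y hy
      rw [norm_mul, Complex.norm_real, Real.norm_of_nonneg hy.le]
      refine (mul_le_mul_of_nonneg_left (hu y hy) hy.le).trans (le_of_eq ?_)
      rw [show (-(1 / 4) : ℝ) = 1 + -(5 / 4) by norm_num, Real.rpow_add hy, Real.rpow_one]
      ring
    have h3 := h1.add_const c
    rw [zero_add] at h3
    refine h3.congr' ?_
    filter_upwards [eventually_gt_atTop 0] with y hy
    have : (y : ℂ) ≠ 0 := by exact_mod_cast hy.ne'
    field_simp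
    ring
  have heq' : ∀ i : ℕ, cauchySum (fun j => α j * lg j) (lg i) =
      -((lam * ((i + 2) * lg i) : ℝ) : ℂ) * α i := fun i => by
    have h1 := cauchySum_mul_lg_add hsum (lg_pos i).le
    have h2 := heq i
    have h3 : (lg i : ℂ) ≠ 0 := by exact_mod_cast (lg_pos i).ne'
    rw [hc] at h1
    have h4 : cauchySum α (lg i) = lam * ((i + 2) * α i) + c / (lg i : ℂ) := by rw [h2]; ring
    rw [h4] at h1
    have h5 : (lg i : ℂ) * (c / (lg i : ℂ)) = c := by field_simp
    push_cast
    linear_combination h1 - h5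
  have hmain := two_mul_re_tsum_conj_mul_cauchySum hsum
  have hterm : ∀ i, conj (α i) * cauchySum (fun j => α j * lg j) (lg i) =
      ((-(lam * ((i + 2) * lg i * ‖α i‖ ^ 2)) : ℝ) : ℂ) := fun i => by
    have h1 := Complex.conj_mul' (α i)
    rw [heq']
    push_cast
    rw [← h1]
    ring
  have hS : Summable fun i : ℕ => (-(lam * ((i + 2) * lg i * ‖α i‖ ^ 2)) : ℝ) := by
    rw [← Complex.summable_ofReal]
    simp_rw [← hterm]
    have h1 : Summable fun i => ‖α i * (lg i : ℂ)‖ / lg i := by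
      simpa only [norm_mul_lg_div] using hsum
    refine Summable.of_norm_bounded (hsum.mul_right (∑' i, ‖α i * (lg i : ℂ)‖ / lg i)) fun i => ?_
    rw [norm_mul, RCLike.norm_conj]
    gcongr
    exact norm_cauchySum_le h1 (lg_pos i).le
  -- The rank-one identity becomes -2λ ∑ n log n |α_i|² = |c|², with sides of opposite sign.
  simp_rw [hterm] at hmain
  rw [← Complex.ofReal_tsum, Complex.ofReal_re, hc] at hmain
  have hneg : ∀ i : ℕ, -(lam * ((i + 2) * lg i * ‖α i‖ ^ 2)) ≤ 0 := fun i => by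
    have := lg_pos i
    have : 0 ≤ lam * ((i + 2) * lg i * ‖α i‖ ^ 2) := by positivity
    linarith
  have hle : ∑' i : ℕ, -(lam * ((i + 2) * lg i * ‖α i‖ ^ 2)) ≤ 0 := tsum_nonpos hneg
  have hc0 : ‖c‖ ^ 2 = 0 := le_antisymm (by linarith) (sq_nonneg _)
  refine ⟨fun i => ?_, by simpa using hc0⟩
  have h0 : ∑' i : ℕ, -(lam * ((i + 2) * lg i * ‖α i‖ ^ 2)) = 0 := by linarith
  have h1 : -(lam * ((i + 2) * lg i * ‖α i‖ ^ 2)) = 0 := by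
    have h2 := hS.neg.le_tsum i fun j _ => by
      have := hneg j
      linarith
    rw [tsum_neg, h0] at h2
    linarith [hneg i]
  have h3 := lg_pos i
  have h4 : (0 : ℝ) < (i : ℝ) + 2 := by positivity
  have h5 : 0 < lam * ((i + 2) * lg i) := by positivity
  have h6 : ‖α i‖ ^ 2 = 0 := by
    have : lam * ((i + 2) * lg i) * ‖α i‖ ^ 2 = 0 := by linarith
    exact (mul_eq_zero.1 this).resolve_left h5.ne'
  simpa using h6

/-- Multiply the k-th moment by (lg m)^k and let k → ∞. Terms with i < m vanish by induction, those
with i > m tend to 0 because `lg` is strictly increasing, and α_m / lg m remains. -/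
lemma eq_zero_of_moments_eq_zero (hα : Summable fun i => ‖α i‖ / lg i)
    (h : ∀ k : ℕ, ∑' i, α i * ((lg i : ℂ)⁻¹) ^ (k + 1) = 0) (m : ℕ) : α m = 0 := by
  induction m using Nat.strong_induction_on with
  | _ m ih =>
    have hm := lg_pos m
    have hlim : Tendsto (fun k : ℕ => ∑' i, α i * (lg i : ℂ)⁻¹ * ((lg m / lg i : ℝ) : ℂ) ^ k) atTop
        (𝓝 (∑' i, if i = m then α i * (lg i : ℂ)⁻¹ else 0)) := by
      refine tendsto_tsum_of_dominated_convergence hα (fun i => ?_) (Eventually.of_forall fun k i => ?_)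
      · rcases lt_trichotomy i m with hi | rfl | hi
        · simp [ih i hi]
        · simp [(lg_pos i).ne']
        · rw [if_neg hi.ne']
          have h1 : ‖((lg m / lg i : ℝ) : ℂ)‖ < 1 := by
            have := lg_pos i
            rw [Complex.norm_real, Real.norm_of_nonneg (by positivity), div_lt_one this]
            exact strictMono_lg hi
          simpa using (tendsto_pow_atTop_nhds_zero_of_norm_lt_one h1).const_mul
            (α i * (lg i : ℂ)⁻¹)
      · have hi := lg_pos i
        rw [norm_mul, norm_mul, norm_inv, Complex.norm_real, Real.norm_of_nonneg hi.le,
          ← div_eq_mul_inv]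
        rcases lt_or_ge i m with him | him
        · simp [ih i him]
        · refine mul_le_of_le_one_right (by positivity) ?_
          rw [_root_.norm_pow, Complex.norm_real, Real.norm_of_nonneg (by positivity)]
          refine pow_le_one₀ (by positivity) ?_
          rw [div_le_one hi]
          exact strictMono_lg.monotone him
    have hzero : ∀ k : ℕ, ∑' i, α i * (lg i : ℂ)⁻¹ * ((lg m / lg i : ℝ) : ℂ) ^ k = 0 := fun k => by
      rw [← mul_zero ((lg m : ℂ) ^ k), ← h k, ← tsum_mul_left]
      refine tsum_congr fun i => ?_
      push_cast
      rw [div_pow, pow_succ, div_eq_mul_inv, inv_pow]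
      ring
    simp_rw [hzero] at hlim
    have h2 := tendsto_nhds_unique hlim tendsto_const_nhds
    rw [tsum_ite_eq] at h2
    have h3 : (lg m : ℂ)⁻¹ ≠ 0 := by
      simpa using hm.ne'
    exact (mul_eq_zero.1 h2).resolve_right h3

/-- The matrix `1 / (lg i + lg j)` is injective. -/
theorem eq_zero_of_cauchySum_eq_zero (hα : Summable fun i => ‖α i‖ / lg i)
    (h : ∀ i, cauchySum α (lg i) = 0) (m : ℕ) : α m = 0 := by
  -- If the Cauchy sum of γ · lg vanishes at all points, the rank-one identity gives ∑ γ = 0, and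
  -- then the Cauchy sum of γ vanishes there too. So one may keep dividing α by `lg`.
  have key : ∀ γ : ℕ → ℂ, (Summable fun i => ‖γ i‖) →
      (∀ i, cauchySum (fun j => γ j * lg j) (lg i) = 0) →
      ∑' i, γ i = 0 ∧ ∀ i, cauchySum γ (lg i) = 0 := by
    intro γ hγ h0
    have h1 := two_mul_re_tsum_conj_mul_cauchySum hγ
    simp only [h0, mul_zero, tsum_zero, Complex.zero_re] at h1
    have h2 : ∑' i, γ i = 0 := by simpa using h1.symm
    refine ⟨h2, fun i => ?_⟩
    have h3 := cauchySum_mul_lg_add hγ (lg_pos i).le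
    rw [h0, h2, zero_add] at h3
    have h4 : (lg i : ℂ) ≠ 0 := by exact_mod_cast (lg_pos i).ne'
    exact (mul_eq_zero.1 h3).resolve_left h4
  have hne : ∀ i, (lg i : ℂ) ≠ 0 := fun i => by exact_mod_cast (lg_pos i).ne'
  have hs : ∀ k : ℕ, Summable fun i => ‖α i * ((lg i : ℂ)⁻¹) ^ (k + 1)‖ := by
    intro k
    refine Summable.of_nonneg_of_le (fun _ => norm_nonneg _) (fun i => ?_) (hα.mul_right (2 ^ k))
    have hi := lg_pos i
    rw [norm_mul, _root_.norm_pow, norm_inv, Complex.norm_real, Real.norm_of_nonneg hi.le, pow_succ',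
      ← mul_assoc, ← div_eq_mul_inv]
    have : (lg i)⁻¹ ≤ 2 := by
      rw [inv_le_comm₀ hi (by norm_num)]
      linarith [half_le_lg i]
    gcongr
  have hk : ∀ k : ℕ, ∀ i, cauchySum (fun j => α j * ((lg j : ℂ)⁻¹) ^ k) (lg i) = 0 := by
    intro k
    induction k with
    | zero => simpa using h
    | succ k ih =>
      refine (key _ (hs k) fun i => ?_).2
      rw [← ih i]
      congr 1
      funext j
      have := hne j
      rw [pow_succ]
      field_simp
  refine eq_zero_of_moments_eq_zero hα (fun k => (key _ (hs k) fun i => ?_).1) m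
  rw [← hk k i]
  congr 1
  funext j
  have := hne j
  rw [pow_succ]
  field_simp

end

/-! ### Transfer to the space of Dirichlet series -/

/-- The enumeration `i ↦ i + 2` of the integers `n ≥ 2`. -/
def idxEquiv : ℕ ≃ Idx where
  toFun i := ⟨i + 2, by omega⟩
  invFun n := (n : ℕ) - 2
  left_inv i := by simp
  right_inv n := by
    apply Subtype.ext
    have := n.2
    simp only
    omega

lemma idxEquiv_cast (i : ℕ) : (((idxEquiv i : Idx) : ℕ) : ℝ) = (i : ℝ) + 2 := by
  simp [idxEquiv]

/-- The coefficients of `f` divided by `√n`, where `n = i + 2`. -/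
def scaledCoeff (f : H20) (i : ℕ) : ℂ := f (idxEquiv i) / ((√((i : ℝ) + 2) : ℝ) : ℂ)

lemma sqrt_add_two_pos (i : ℕ) : 0 < √((i : ℝ) + 2) := Real.sqrt_pos.2 (by positivity)

lemma sqrt_add_two_ne_zero (i : ℕ) : ((√((i : ℝ) + 2) : ℝ) : ℂ) ≠ 0 := by
  exact_mod_cast (sqrt_add_two_pos i).ne'

lemma summable_scaledCoeff (f : H20) :
    Summable fun i : ℕ => (i + 2 : ℝ) * ‖scaledCoeff f i‖ ^ 2 := by
  refine (idxEquiv.summable_iff.2 (summable_norm_sq f)).congr fun i => ?_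
  have h : (0 : ℝ) < (i : ℝ) + 2 := by positivity
  rw [scaledCoeff, norm_div, Complex.norm_real, Real.norm_of_nonneg (Real.sqrt_nonneg _), div_pow,
    Real.sq_sqrt h.le, Function.comp_apply]
  field_simp

lemma eq_zero_of_scaledCoeff_eq_zero {f : H20} (h : ∀ i, scaledCoeff f i = 0) : f = 0 := by
  ext n
  have h1 := h (idxEquiv.symm n)
  rw [scaledCoeff, idxEquiv.apply_symm_apply, div_eq_zero_iff] at h1
  simpa using h1.resolve_right (sqrt_add_two_ne_zero _)

/-- The factor 1/√(mn) of the kernel splits: 1/√m goes into the scaled coefficient and 1/√n is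
cancelled on the left, leaving 1/(log m + log n). -/
lemma sqrt_mul_coef (f : H20) (i : ℕ) :
    ((√((i : ℝ) + 2) : ℝ) : ℂ) * coef f (idxEquiv i) = cauchySum (scaledCoeff f) (lg i) := by
  rw [coef, ← idxEquiv.tsum_eq, ← tsum_mul_left, cauchySum]
  refine tsum_congr fun j => ?_
  have h1 := sqrt_add_two_ne_zero i
  have h2 := sqrt_add_two_ne_zero j
  have h3 : ((lg j : ℂ) + lg i) ≠ 0 := by
    exact_mod_cast (add_pos (lg_pos j) (lg_pos i)).ne'
  rw [ker, log_mul', idxEquiv_cast, idxEquiv_cast, Real.sqrt_mul (by positivity), scaledCoeff]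
  change _ * (((1 / (_ * (lg j + lg i)) : ℝ) : ℂ) * _) = _
  push_cast
  field_simp

lemma sqrt_mul_symbol (i : ℕ) :
    ((√((i : ℝ) + 2) : ℝ) : ℂ) * symbol (idxEquiv i) = 1 / (lg i : ℂ) := by
  have h1 := sqrt_add_two_ne_zero i
  have h3 : (lg i : ℂ) ≠ 0 := by exact_mod_cast (lg_pos i).ne'
  change _ * ((1 / (√(((idxEquiv i : Idx) : ℕ) : ℝ) * Real.log ((idxEquiv i : Idx) : ℕ)) : ℝ) : ℂ) = _
  rw [idxEquiv_cast]
  change _ * ((1 / (_ * lg i) : ℝ) : ℂ) = _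
  push_cast
  field_simp

/-- For `0 < lam ≤ π` the equation `(H - lam) f = c ψ` has only the trivial solution. -/
theorem eq_zero_of_sub_smul_eq_smul_symbol {lam : ℝ} (h0 : 0 < lam) (h1 : lam ≤ Real.pi) {f : H20}
    {c : ℂ} (h : hilbertOp f - (lam : ℂ) • f = c • symbol) : f = 0 ∧ c = 0 := by
  rw [hilbertOp_eq_matrixOp] at h
  obtain ⟨h2, h3⟩ := eq_zero_of_cauchySum_equation (summable_scaledCoeff f) h0 h1 (c := c)
    fun i => by
      have h4 := congrArg (fun g : H20 => ((√((i : ℝ) + 2) : ℝ) : ℂ) * g (idxEquiv i)) h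
      simp only [lp.coeFn_sub, lp.coeFn_smul, Pi.sub_apply, Pi.smul_apply, smul_eq_mul,
        matrixOp_apply] at h4
      rw [mul_sub, sqrt_mul_coef] at h4
      have h5 : f (idxEquiv i) = ((√((i : ℝ) + 2) : ℝ) : ℂ) * scaledCoeff f i := by
        rw [scaledCoeff, mul_div_cancel₀ _ (sqrt_add_two_ne_zero i)]
      have h6 : ((√((i : ℝ) + 2) : ℝ) : ℂ) * ((√((i : ℝ) + 2) : ℝ) : ℂ) = (i : ℂ) + 2 := by
        rw [← Complex.ofReal_mul, Real.mul_self_sqrt (by positivity)]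
        push_cast
        rfl
      have h7 := sqrt_mul_symbol i
      rw [h5] at h4
      rw [← h6, ← mul_one_div c, ← h7]
      linear_combination -h4
  exact ⟨eq_zero_of_scaledCoeff_eq_zero h2, h3⟩

theorem eq_zero_of_hilbertOp_eq_zero {f : H20} (h : hilbertOp f = 0) : f = 0 := by
  rw [hilbertOp_eq_matrixOp] at h
  refine eq_zero_of_scaledCoeff_eq_zero (eq_zero_of_cauchySum_eq_zero
    (summable_norm_div_lg (summable_scaledCoeff f)) fun i => ?_)
  rw [← sqrt_mul_coef, ← matrixOp_apply, h]
  simp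

/-! ### Self-adjointness, positivity and the spectrum -/

lemma coef_single (n k : Idx) (a : ℂ) : coef (lp.single 2 n a) k = ker n k * a := by
  rw [coef, tsum_eq_single n]
  · simp
  · intro m hm
    simp [hm]

lemma isSelfAdjoint_matrixOp : IsSelfAdjoint matrixOp := by
  rw [ContinuousLinearMap.isSelfAdjoint_iff']
  refine ContinuousLinearMap.ext fun g => ?_
  ext n
  have h1 : inner ℂ (lp.single 2 n (1 : ℂ) : H20) (ContinuousLinearMap.adjoint matrixOp g) =
      ContinuousLinearMap.adjoint matrixOp g n := by
    rw [lp.inner_single_left]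
    simp
  rw [← h1, ContinuousLinearMap.adjoint_inner_right, lp.inner_eq_tsum, matrixOp_apply, coef]
  refine tsum_congr fun m => ?_
  rw [matrixOp_apply, coef_single, mul_one, RCLike.inner_apply, Complex.conj_ofReal, ker_comm,
    mul_comm]

/-- The kernel is a Gram matrix: its entries are ∫ (mn)^(-w) dw over w > 1/2, so the quadratic form
is the integral of |∑ a_m m^(-w)|². -/
lemma sum_ker_nonneg (s : Finset Idx) (a : Idx → ℂ) :
    0 ≤ (∑ m ∈ s, ∑ n ∈ s, (ker m n : ℂ) * (conj (a m) * a n)).re := by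
  have hint : ∀ m n : Idx, Integrable (fun w : ℝ =>
      (Real.exp (-Real.log ((m : ℕ) * (n : ℕ)) * w) : ℂ) * (conj (a m) * a n))
      (volume.restrict (Ioi (1 / 2 : ℝ))) := fun m n => by
    have := (integrable_exp_ker m n).ofReal (𝕜 := ℂ)
    exact this.mul_const _
  have h1 : ∑ m ∈ s, ∑ n ∈ s, (ker m n : ℂ) * (conj (a m) * a n) =
      ∫ w in Ioi (1 / 2 : ℝ), ((‖∑ m ∈ s, (Real.exp (-Real.log (m : ℕ) * w) : ℂ) * a m‖ ^ 2 : ℝ) : ℂ) := by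
    have h2 : ∀ w : ℝ, ((‖∑ m ∈ s, (Real.exp (-Real.log (m : ℕ) * w) : ℂ) * a m‖ ^ 2 : ℝ) : ℂ) =
        ∑ m ∈ s, ∑ n ∈ s, (Real.exp (-Real.log ((m : ℕ) * (n : ℕ)) * w) : ℂ) *
          (conj (a m) * a n) := fun w => by
      rw [Complex.ofReal_pow, ← Complex.conj_mul', map_sum, Finset.sum_mul_sum]
      refine Finset.sum_congr rfl fun m _ => Finset.sum_congr rfl fun n _ => ?_
      rw [map_mul, Complex.conj_ofReal, log_mul', neg_add, add_mul, Real.exp_add]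
      push_cast
      ring
    simp_rw [h2]
    rw [integral_finsetSum _ fun m _ => integrable_finsetSum _ fun n _ => hint m n]
    refine Finset.sum_congr rfl fun m _ => ?_
    rw [integral_finsetSum _ fun n _ => hint m n]
    refine Finset.sum_congr rfl fun n _ => ?_
    rw [integral_mul_const, integral_complex_ofReal, integral_exp_ker]
  rw [h1, integral_complex_ofReal, Complex.ofReal_re]
  exact integral_nonneg fun w => by positivity

lemma isPositive_matrixOp : matrixOp.IsPositive := by
  rw [ContinuousLinearMap.isPositive_def']
  refine ⟨isSelfAdjoint_matrixOp, fun f => ?_⟩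
  have h1 : Tendsto (fun s : Finset Idx => ∑ i ∈ s, (lp.single 2 i (f i) : H20)) atTop (𝓝 f) :=
    lp.hasSum_single (by norm_num) f
  refine ge_of_tendsto ((matrixOp.reApplyInnerSelf_continuous.tendsto f).comp h1)
    (Eventually.of_forall fun s => ?_)
  rw [Function.comp_apply, ContinuousLinearMap.reApplyInnerSelf_apply, map_sum, sum_inner]
  simp_rw [inner_sum]
  refine (sum_ker_nonneg s f).trans (le_of_eq ?_)
  congr 1
  refine Finset.sum_congr rfl fun m _ => Finset.sum_congr rfl fun n _ => ?_
  rw [lp.inner_single_right, matrixOp_apply, coef_single, RCLike.inner_apply, map_mul,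
    Complex.conj_ofReal]
  ring

lemma norm_matrixOp_le : ‖matrixOp‖ ≤ Real.pi :=
  LinearMap.mkContinuous_norm_le _ Real.pi_pos.le _

lemma symbol_ne_zero : symbol ≠ 0 := by
  intro h
  have h1 := sqrt_mul_symbol 0
  have h2 : symbol (idxEquiv 0) = 0 := by rw [h]; simp
  rw [h2, mul_zero] at h1
  have h3 : (lg 0 : ℂ) ≠ 0 := by exact_mod_cast (lg_pos 0).ne'
  exact one_div_ne_zero h3 h1.symm

/-- Self-adjointness makes the spectrum real, positivity bounds it below by 0, and the Schur bound
on the norm bounds it above by π. -/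
lemma spectrum_hilbertOp_subset :
    spectrum ℂ hilbertOp ⊆ (fun x : ℝ => (x : ℂ)) '' Icc 0 Real.pi := by
  rw [hilbertOp_eq_matrixOp]
  intro μ hμ
  have : Nontrivial H20 := ⟨symbol, 0, symbol_ne_zero⟩
  have hre := isSelfAdjoint_matrixOp.mem_spectrum_eq_re hμ
  have hn := (spectrum.norm_le_norm_of_mem hμ).trans norm_matrixOp_le
  rw [hre] at hμ hn ⊢
  refine ⟨μ.re, ⟨?_, ?_⟩, rfl⟩
  · refine SpectrumRestricts.nnreal_iff.1 isPositive_matrixOp.spectrumRestricts _ ?_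
    rw [← spectrum.algebraMap_mem_iff ℂ]
    exact hμ
  · rw [Complex.norm_real] at hn
    exact (le_abs_self _).trans hn

lemma mem_spectrum_hilbertOp_iff {μ : ℂ} : μ ∈ spectrum ℂ hilbertOp ↔
    ¬ Function.Bijective fun f : H20 => hilbertOp f - μ • f := by
  rw [spectrum.mem_iff, ← IsUnit.neg_iff, neg_sub, ContinuousLinearMap.isUnit_iff_bijective]
  have : ⇑(hilbertOp - algebraMap ℂ (H20 →L[ℂ] H20) μ) = fun f : H20 => hilbertOp f - μ • f := by
    funext f
    simp [Algebra.algebraMap_eq_smul_one]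
  rw [this]

lemma not_surjective_hilbertOp_sub {lam : ℝ} (h0 : 0 < lam) (h1 : lam ≤ Real.pi) :
    ¬ Function.Surjective fun f : H20 => hilbertOp f - (lam : ℂ) • f := by
  intro h
  obtain ⟨f, hf⟩ := h symbol
  exact one_ne_zero (eq_zero_of_sub_smul_eq_smul_symbol h0 h1 (c := 1) (by rw [one_smul]; exact hf)).2

lemma spectrum_hilbertOp :
    spectrum ℂ hilbertOp = (fun x : ℝ => (x : ℂ)) '' Icc 0 Real.pi := by
  refine spectrum_hilbertOp_subset.antisymm ?_
  -- The points of (0, π] are spectral because ψ is not attained; 0 comes from the closedness of the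
  -- spectrum.
  rw [← closure_Ioc Real.pi_pos.ne]
  refine (image_closure_subset_closure_image Complex.continuous_ofReal).trans
    (closure_minimal ?_ (spectrum.isClosed (𝕜 := ℂ) hilbertOp))
  rintro _ ⟨lam, hlam, rfl⟩
  exact mem_spectrum_hilbertOp_iff.2 fun h => not_surjective_hilbertOp_sub hlam.1 hlam.2 h.2

lemma eq_zero_of_hilbertOp_eq_smul {lam : ℝ} (hlam : lam ∈ Icc 0 Real.pi) {f : H20}
    (hf : hilbertOp f = (lam : ℂ) • f) : f = 0 := by
  rcases hlam.1.eq_or_lt with rfl | h0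
  · exact eq_zero_of_hilbertOp_eq_zero (by simpa using hf)
  · exact (eq_zero_of_sub_smul_eq_smul_symbol h0 hlam.2 (c := 0) (by rw [hf]; simp)).1

lemma injective_hilbertOp_sub {lam : ℝ} (hlam : lam ∈ Icc 0 Real.pi) :
    Function.Injective fun f : H20 => hilbertOp f - (lam : ℂ) • f := by
  intro f g hfg
  refine sub_eq_zero.1 (eq_zero_of_hilbertOp_eq_smul hlam ?_)
  simp only at hfg
  rw [map_sub, smul_sub]
  exact sub_eq_sub_iff_sub_eq_sub.1 hfg

/-- The orthogonal complement of the range is the kernel of the adjoint, which is the same operator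
as λ is real. -/
lemma denseRange_hilbertOp_sub {lam : ℝ} (hlam : lam ∈ Icc 0 Real.pi) :
    DenseRange fun f : H20 => hilbertOp f - (lam : ℂ) • f := by
  set T : H20 →L[ℂ] H20 := hilbertOp - (lam : ℂ) • 1 with hT
  have hTf : ⇑T = fun f : H20 => hilbertOp f - (lam : ℂ) • f := rfl
  have hadj : ContinuousLinearMap.adjoint T = T := by
    rw [← ContinuousLinearMap.isSelfAdjoint_iff', hT, hilbertOp_eq_matrixOp]
    refine isSelfAdjoint_matrixOp.sub (IsSelfAdjoint.smul ?_ (.one _))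
    exact Complex.conj_ofReal lam
  have hker : T.ker = ⊥ := by
    refine LinearMap.ker_eq_bot.2 ?_
    have := injective_hilbertOp_sub hlam
    rw [← hTf] at this
    exact this
  have horth := T.orthogonal_range
  rw [hadj, hker, ← Submodule.topologicalClosure_eq_top_iff,
    ← Submodule.dense_iff_topologicalClosure_eq_top] at horth
  rw [← hTf]
  have hrange : (T.range : Set H20) = range T := LinearMap.coe_range _
  rwa [hrange] at horth

lemma pointSpectrum_hilbertOp : pointSpectrum hilbertOp = ∅ := by
  refine eq_empty_of_forall_notMem ?_
  rintro μ ⟨f, hf0, hf⟩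
  have hμ : μ ∈ spectrum ℂ hilbertOp := mem_spectrum_hilbertOp_iff.2 fun h =>
    hf0 (h.1 (by simp [hf]))
  obtain ⟨lam, hlam, rfl⟩ := spectrum_hilbertOp_subset hμ
  exact hf0 (eq_zero_of_hilbertOp_eq_smul hlam hf)

/-- Being in the spectrum means failing to be bijective, so injectivity leaves only failure of
surjectivity; this also settles the point 0. -/
lemma continuousSpectrum_hilbertOp : continuousSpectrum hilbertOp = spectrum ℂ hilbertOp := by
  ext μ
  refine ⟨fun h => mem_spectrum_hilbertOp_iff.2 fun hb => h.2.2 hb.2, fun h => ?_⟩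
  have h1 := mem_spectrum_hilbertOp_iff.1 h
  obtain ⟨lam, hlam, rfl⟩ := spectrum_hilbertOp_subset h
  have h2 := injective_hilbertOp_sub hlam
  exact ⟨h2, denseRange_hilbertOp_sub hlam, fun hs => h1 ⟨h2, hs⟩⟩

end MulHilbert

end

theorem theorem4 :
    -- no point spectrum
    MulHilbert.pointSpectrum MulHilbert.hilbertOp = ∅ ∧
    -- the equation `(H - lam) f = c ψ` has only the trivial solution
    (∀ lam : ℝ, 0 < lam → lam < Real.pi → ∀ (f : MulHilbert.H20) (c : ℂ),
      MulHilbert.hilbertOp f - (lam : ℂ) • f = c • MulHilbert.symbol → f = 0 ∧ c = 0) ∧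
    -- `H - lam` does not have full range
    (∀ lam : ℝ, 0 < lam → lam < Real.pi →
      ¬ Function.Surjective
        (fun f : MulHilbert.H20 => MulHilbert.hilbertOp f - (lam : ℂ) • f)) ∧
    -- the spectrum is `[0, π]` and purely continuous
    spectrum ℂ MulHilbert.hilbertOp = (fun x : ℝ => (x : ℂ)) '' Set.Icc 0 Real.pi ∧
    MulHilbert.continuousSpectrum MulHilbert.hilbertOp =
      spectrum ℂ MulHilbert.hilbertOp :=
  ⟨MulHilbert.pointSpectrum_hilbertOp,
    fun _ h0 h1 _ _ h => MulHilbert.eq_zero_of_sub_smul_eq_smul_symbol h0 h1.le h,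
    fun _ h0 h1 => MulHilbert.not_surjective_hilbertOp_sub h0 h1.le,
    MulHilbert.spectrum_hilbertOp, MulHilbert.continuousSpectrum_hilbertOp⟩
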